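/- Conventions. Manifolds are smooth and Hausdorff. Let $(\bar M,\bar\nabla,\bar g,\phi,\nu)$ be an indefinite Kenmotsu statistical manifold of dimension $2n+1$. This means the following. $\bar g$ is a semi-Riemannian metric of constant index $\ge 1$. $\phi$ is a $(1,1)$-tensor field, $\nu$ a vector field and $\eta$ a $1$-form with $\bar g(\phi X,\phi Y)=\bar g(X,Y)-\eta(X)\eta(Y)$, $\bar g(\nu,\nu)=1$, $\phi^2X=-X+\eta(X)\nu$, $\bar g(X,\nu)=\eta(X)$ and $\bar g(\phi X,Y)+\bar g(X,\phi Y)=0$. The Levi-Civita connection $\widehat{\bar\nabla}$ of $\bar g$ satisfies $(\widehat{\bar\nabla}_X\phi)Y=\eta(Y)\phi X-\bar g(\phi X,Y)\nu$ and $\widehat{\bar\nabla}_X\nu=-X+\eta(X)\nu$. The affine connection $\bar\nabla$ is torsion-free, $(\bar\nabla_X\bar g)(Y,Z)=(\bar\nabla_Y\bar g)(X,Z)$, and $K=\bar\nabla-\widehat{\bar\nabla}$ satisfies $K(X,\phi Y)=-\phi K(X,Y)$. Let $\bar\nabla^*$ be the dual connection, $X\bar g(Y,Z)=\bar g(\bar\nabla_XY,Z)+\bar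 g(Y,\bar\nabla^*_XZ)$. Let $M$ be a lightlike submanifold immersed in $\bar M$. Its radical distribution $\mathrm{Rad}(TM)=TM\cap TM^\perp$ has constant rank $r$ with $1\le r\le\dim M$. There are a screen distribution $S(TM)$ and a screen transversal bundle $S(TM^\perp)$, with $TM=\mathrm{Rad}(TM)\perp S(TM)$ and $TM^\perp=\mathrm{Rad}(TM)\perp S(TM^\perp)$. There is also a lightlike transversal bundle $\mathrm{ltr}(TM)$ contained in $S(TM)^\perp\cap S(TM^\perp)^\perp$: for each local frame $(\xi_j)$ of $\mathrm{Rad}(TM)$ it has a local frame $(N_j)$ with $\bar g(\xi_j,N_k)=\delta_{jk}$ and $\bar g(N_j,N_k)=0$. Then $T\bar M|_M=TM\oplus\mathrm{ltr}(TM)\oplus S(TM^\perp)$. For $X,Y\in\Gamma(TM)$ let $h^l(X,Y)$ and $h^s(X,Y)$ be the components of $\bar\nabla_XY$ in $\mathrm{ltr}(TM)$ and $S(TM^\perp)$. Let $h^{*l}(X,Y)$ and $h^{*s}(X,Y)$ be those of $\bar\nabla^*_XY$, and let $\widehat\nabla_XY$ be the component of $\widehat{\bar\nabla}_XY$ in $TM$.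 Suppose that $M$ is a contact $CR$-lightlike submanifold. This means that $\nu$ is tangent to $M$, that $\mathrm{Rad}(TM)\cap\phi(\mathrm{Rad}(TM))=\{0\}$, and that there are vector bundles $D_0,D'$ over $M$ and a subbundle $L_1\subseteq S(TM^\perp)$ with $$S(TM)=\{\phi(\mathrm{Rad}(TM))\oplus D'\}\perp D_0\perp\{\nu\},\qquad \phi D_0=D_0,\qquad \phi(D')=L_1\perp\mathrm{ltr}(TM),$$ where $D_0$ is non-degenerate. Put $D=\mathrm{Rad}(TM)\perp\phi(\mathrm{Rad}(TM))\perp D_0$. A distribution $F$ on $M$ is said to define a totally geodesic foliation in $M$ if it is involutive and $\widehat\nabla_XY\in\Gamma(F)$ for all $X,Y\in\Gamma(F)$. **Theorem.** $D\perp\{\nu\}$ defines a totally geodesic foliation in $M$ if and only if $$\bar g(h^{*l}(X,\phi Y),\xi)+\bar g(h^{l}(X,\phi Y),\xi)=0\quad\text{and}\quad \bar g(h^{*s}(X,Y),\phi W)+\bar g(h^{s}(X,Y),\phi W)=0$$ for all $X,Y\in\Gamma(D\perp\{\nu\})$, all $\xi\in\Gamma(\mathrm{Rad}(TM))$ and all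 $W\in\Gamma(\phi L_1)$. -/

import Mathlib

open Bundle Set Filter
open scoped Manifold ContDiff Topology

noncomputable section

/-! ## Semi-Riemannian metrics and affine connections -/

section Ambient

variable (d : ℕ) (N : Type*) [TopologicalSpace N] [ChartedSpace (EuclideanSpace ℝ (Fin d)) N]
  [IsManifold (𝓡 d) ∞ N]

/-- A smooth semi-Riemannian metric of constant index on a `d`-dimensional manifold `N`. -/
structure SemiRiemannianMetric where
  /-- the scalar product on each tangent space -/
  val : ∀ x : N, TangentSpace (𝓡 d) x →L[ℝ] TangentSpace (𝓡 d) x →L[ℝ] ℝ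
  symm : ∀ (x : N) (u v : TangentSpace (𝓡 d) x), val x u v = val x v u
  nondegenerate : ∀ (x : N) (u : TangentSpace (𝓡 d) x), (∀ v, val x u v = 0) → u = 0
  smooth : ContMDiff (𝓡 d)
    ((𝓡 d).prod 𝓘(ℝ, EuclideanSpace ℝ (Fin d) →L[ℝ] EuclideanSpace ℝ (Fin d) →L[ℝ] ℝ)) ∞
    (fun x ↦ TotalSpace.mk'
      (EuclideanSpace ℝ (Fin d) →L[ℝ] EuclideanSpace ℝ (Fin d) →L[ℝ] ℝ) x (val x))
  /-- the index, i.e. the maximal dimension of a negative definite subspace -/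
  index : ℕ
  index_eq : ∀ x : N,
    sigNeg (LinearMap.BilinMap.toQuadraticMap (val x).toBilinForm) = index

/-- An affine connection on `N`; `nabla Y x (X x)` is `(∇_X Y)(x)`. -/
abbrev AffineConnection (d : ℕ) (N : Type*) [TopologicalSpace N]
    [ChartedSpace (EuclideanSpace ℝ (Fin d)) N] [IsManifold (𝓡 d) ∞ N] : Type _ :=
  CovariantDerivative (𝓡 d) (EuclideanSpace ℝ (Fin d)) (TangentSpace (𝓡 d) : N → Type _)

/-- The vector field `Y` is differentiable at `x`. -/
abbrev IsDiffField (d : ℕ) {N : Type*} [TopologicalSpace N]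
    [ChartedSpace (EuclideanSpace ℝ (Fin d)) N] [IsManifold (𝓡 d) ∞ N]
    (Y : ∀ x : N, TangentSpace (𝓡 d) x) (x : N) :
    Prop :=
  MDifferentiableAt (𝓡 d) ((𝓡 d).prod 𝓘(ℝ, EuclideanSpace ℝ (Fin d)))
    (fun y ↦ (⟨y, Y y⟩ : TangentBundle (𝓡 d) N)) x

variable {d N}

/-- The function `g(Y, Z)`. -/
def SemiRiemannianMetric.pairing (g : SemiRiemannianMetric d N)
    (Y Z : ∀ x : N, TangentSpace (𝓡 d) x) : N → ℝ := fun x ↦ g.val x (Y x) (Z x)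

/-- The covariant derivative of the metric,
`(∇_X g)(Y, Z) = X g(Y, Z) - g(∇_X Y, Z) - g(Y, ∇_X Z)`. -/
def SemiRiemannianMetric.covDeriv (g : SemiRiemannianMetric d N) (nabla : AffineConnection d N)
    (X Y Z : ∀ x : N, TangentSpace (𝓡 d) x) (x : N) : ℝ :=
  mvfderiv (𝓡 d) (g.pairing Y Z) x (X x)
    - g.val x (nabla Y x (X x)) (Z x) - g.val x (Y x) (nabla Z x (X x))

/-- `∇_X Y - ∇_Y X = [X, Y]`. -/
def AffineConnection.IsTorsionFree (nabla : AffineConnection d N) : Prop :=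
  ∀ (x : N) (X Y : ∀ x : N, TangentSpace (𝓡 d) x), IsDiffField d X x → IsDiffField d Y x →
    nabla Y x (X x) - nabla X x (Y x) = VectorField.mlieBracket (𝓡 d) X Y x

/-- `nabla` is the Levi-Civita connection of `g`: it is torsion-free and `∇ g = 0`. -/
def SemiRiemannianMetric.IsLeviCivita (g : SemiRiemannianMetric d N)
    (nabla : AffineConnection d N) : Prop :=
  AffineConnection.IsTorsionFree nabla ∧
    ∀ (x : N) (X Y Z : ∀ x : N, TangentSpace (𝓡 d) x),
      IsDiffField d X x → IsDiffField d Y x → IsDiffField d Z x → g.covDeriv nabla X Y Z x = 0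

/-- `(nabla, g)` is a statistical structure: `nabla` is torsion-free and
`(∇_X g)(Y, Z) = (∇_Y g)(X, Z)`. -/
def SemiRiemannianMetric.IsStatistical (g : SemiRiemannianMetric d N)
    (nabla : AffineConnection d N) : Prop :=
  AffineConnection.IsTorsionFree nabla ∧
    ∀ (x : N) (X Y Z : ∀ x : N, TangentSpace (𝓡 d) x),
      IsDiffField d X x → IsDiffField d Y x → IsDiffField d Z x →
        g.covDeriv nabla X Y Z x = g.covDeriv nabla Y X Z x

/-- `nablaStar` is the dual connection of `nabla` with respect to `g`:
`X g(Y, Z) = g(∇_X Y, Z) + g(Y, ∇*_X Z)`. -/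
def SemiRiemannianMetric.IsDual (g : SemiRiemannianMetric d N)
    (nabla nablaStar : AffineConnection d N) : Prop :=
  ∀ (x : N) (X Y Z : ∀ x : N, TangentSpace (𝓡 d) x),
    IsDiffField d X x → IsDiffField d Y x → IsDiffField d Z x →
      mvfderiv (𝓡 d) (g.pairing Y Z) x (X x) =
        g.val x (nabla Y x (X x)) (Z x) + g.val x (Y x) (nablaStar Z x (X x))

/-! ## Almost contact metric structures and Kenmotsu statistical structures -/

/-- An almost contact metric structure `(φ, ν, η)` for the metric `g`. -/
structure AlmostContactMetric (g : SemiRiemannianMetric d N) where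
  /-- the `(1,1)`-tensor field -/
  φ : ∀ x : N, TangentSpace (𝓡 d) x →L[ℝ] TangentSpace (𝓡 d) x
  φ_smooth : ContMDiff (𝓡 d)
    ((𝓡 d).prod 𝓘(ℝ, EuclideanSpace ℝ (Fin d) →L[ℝ] EuclideanSpace ℝ (Fin d))) ∞
    (fun x ↦ TotalSpace.mk' (EuclideanSpace ℝ (Fin d) →L[ℝ] EuclideanSpace ℝ (Fin d))
      (E := fun x : N ↦ TangentSpace (𝓡 d) x →L[ℝ] TangentSpace (𝓡 d) x) x (φ x))
  /-- the characteristic (structure) vector field -/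
  ν : ∀ x : N, TangentSpace (𝓡 d) x
  ν_smooth : ContMDiff (𝓡 d) ((𝓡 d).prod 𝓘(ℝ, EuclideanSpace ℝ (Fin d))) ∞
    (fun x ↦ (⟨x, ν x⟩ : TangentBundle (𝓡 d) N))
  /-- the `1`-form -/
  η : ∀ x : N, TangentSpace (𝓡 d) x →L[ℝ] ℝ
  g_φ_φ : ∀ (x : N) (u v : TangentSpace (𝓡 d) x),
    g.val x (φ x u) (φ x v) = g.val x u v - η x u * η x v
  g_ν_ν : ∀ x : N, g.val x (ν x) (ν x) = 1
  φ_φ : ∀ (x : N) (u : TangentSpace (𝓡 d) x), φ x (φ x u) = -u + η x u • ν x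
  g_ν : ∀ (x : N) (u : TangentSpace (𝓡 d) x), g.val x u (ν x) = η x u
  g_φ : ∀ (x : N) (u v : TangentSpace (𝓡 d) x), g.val x (φ x u) v + g.val x u (φ x v) = 0

/-- The almost contact metric structure is a Kenmotsu structure with respect to the Levi-Civita
connection `hatNabla`:
`(∇_X φ) Y = η(Y) φX - g(φX, Y) ν` and `∇_X ν = -X + η(X) ν`. -/
def AlmostContactMetric.IsKenmotsu {g : SemiRiemannianMetric d N} (A : AlmostContactMetric g)
    (hatNabla : AffineConnection d N) : Prop :=
  (∀ (x : N) (u : TangentSpace (𝓡 d) x) (Y : ∀ x : N, TangentSpace (𝓡 d) x), IsDiffField d Y x →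
    hatNabla (fun y ↦ A.φ y (Y y)) x u - A.φ x (hatNabla Y x u) =
      A.η x (Y x) • A.φ x u - g.val x (A.φ x u) (Y x) • A.ν x) ∧
  ∀ (x : N) (u : TangentSpace (𝓡 d) x), hatNabla A.ν x u = -u + A.η x u • A.ν x

end Ambient

/-- An indefinite Kenmotsu statistical structure on a `(2n+1)`-dimensional manifold `N`, together
with the connections which it determines: the dual connection `nablaStar` of `nabla`, and the
Levi-Civita connection `hatNabla` of the metric. -/
structure IndefiniteKenmotsuStatistical (n : ℕ) (N : Type*) [TopologicalSpace N]
    [ChartedSpace (EuclideanSpace ℝ (Fin (2 * n + 1))) N]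
    [IsManifold (𝓡 (2 * n + 1)) ∞ N] where
  /-- the metric -/
  g : SemiRiemannianMetric (2 * n + 1) N
  indefinite : 1 ≤ g.index
  /-- the tensors `φ`, `ν`, `η` -/
  contact : AlmostContactMetric g
  /-- the statistical connection -/
  nabla : AffineConnection (2 * n + 1) N
  nabla_smooth : CovariantDerivative.ContMDiffCovariantDerivative nabla ∞
  /-- the dual connection -/
  nablaStar : AffineConnection (2 * n + 1) N
  /-- the Levi-Civita connection -/
  hatNabla : AffineConnection (2 * n + 1) N
  isLeviCivita : g.IsLeviCivita hatNabla
  isStatistical : g.IsStatistical nabla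
  isDual : g.IsDual nabla nablaStar
  isKenmotsu : contact.IsKenmotsu hatNabla
  /-- `K(X, φY) = - φ K(X, Y)` for the difference tensor `K(X, Y) = ∇_X Y - hat∇_X Y` -/
  difference_φ : ∀ (x : N) (u : TangentSpace (𝓡 (2 * n + 1)) x)
    (Y : ∀ x : N, TangentSpace (𝓡 (2 * n + 1)) x), IsDiffField (2 * n + 1) Y x →
    nabla (fun y ↦ contact.φ y (Y y)) x u - hatNabla (fun y ↦ contact.φ y (Y y)) x u =
      -contact.φ x (nabla Y x u - hatNabla Y x u)

/-! ## Vector fields along an immersion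

For an immersion `i : M → N`, all the bundles over `M` that occur below are subbundles of the
pullback bundle `i^* TN`. In particular `TM` is identified with the subbundle `di(TM)`. -/

section Along

variable {d m : ℕ} {N : Type*} [TopologicalSpace N] [ChartedSpace (EuclideanSpace ℝ (Fin d)) N]
  [IsManifold (𝓡 d) ∞ N]
  {M : Type*} [TopologicalSpace M] [ChartedSpace (EuclideanSpace ℝ (Fin m)) M]
  [IsManifold (𝓡 m) ∞ M]

/-- A family of subspaces of the fibres of `i^* TN`. -/
abbrev FibreFamily (d : ℕ) {N : Type*} [TopologicalSpace N]
    [ChartedSpace (EuclideanSpace ℝ (Fin d)) N] {M : Type*} (i : M → N) :=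
  ∀ p : M, Submodule ℝ (TangentSpace (𝓡 d) (i p))

/-- A section of `i^* TN`, i.e. a (not necessarily smooth) vector field along `i`. -/
abbrev FieldAlong (d : ℕ) {N : Type*} [TopologicalSpace N]
    [ChartedSpace (EuclideanSpace ℝ (Fin d)) N] {M : Type*} (i : M → N) :=
  ∀ p : M, TangentSpace (𝓡 d) (i p)

/-- The vector field along `i` is smooth on the set `U`. -/
def SmoothAlongOn (m : ℕ) {d : ℕ} {N : Type*} [TopologicalSpace N]
    [ChartedSpace (EuclideanSpace ℝ (Fin d)) N] [IsManifold (𝓡 d) ∞ N]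
    {M : Type*} [TopologicalSpace M] [ChartedSpace (EuclideanSpace ℝ (Fin m)) M]
    (i : M → N) (Z : FieldAlong d i) (U : Set M) : Prop :=
  ContMDiffOn (𝓡 m) ((𝓡 d).prod 𝓘(ℝ, EuclideanSpace ℝ (Fin d))) ∞
    (fun p ↦ (⟨i p, Z p⟩ : TangentBundle (𝓡 d) N)) U

/-- `Z ∈ Γ(F)`: `Z` is a smooth vector field along `i` with values in `F`. -/
def IsSection (m : ℕ) {d : ℕ} {N : Type*} [TopologicalSpace N]
    [ChartedSpace (EuclideanSpace ℝ (Fin d)) N] [IsManifold (𝓡 d) ∞ N]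
    {M : Type*} [TopologicalSpace M] [ChartedSpace (EuclideanSpace ℝ (Fin m)) M]
    (i : M → N) (F : FibreFamily d i) (Z : FieldAlong d i) : Prop :=
  SmoothAlongOn m i Z univ ∧ ∀ p, Z p ∈ F p

/-- `s` is a smooth frame of `F` over the open set `U`. -/
structure IsFrameOn (m : ℕ) {d : ℕ} {N : Type*} [TopologicalSpace N]
    [ChartedSpace (EuclideanSpace ℝ (Fin d)) N] [IsManifold (𝓡 d) ∞ N]
    {M : Type*} [TopologicalSpace M] [ChartedSpace (EuclideanSpace ℝ (Fin m)) M]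
    (i : M → N) {k : ℕ} (F : FibreFamily d i) (U : Set M) (s : Fin k → FieldAlong d i) :
    Prop where
  isOpen : IsOpen U
  smooth : ∀ j, SmoothAlongOn m i (s j) U
  linearIndependent : ∀ p ∈ U, LinearIndependent ℝ (fun j ↦ s j p)
  span_eq : ∀ p ∈ U, Submodule.span ℝ (Set.range fun j ↦ s j p) = F p

/-- `F` is a smooth vector subbundle of `i^* TN` of rank `k`. -/
def IsSubbundle (m : ℕ) {d : ℕ} {N : Type*} [TopologicalSpace N]
    [ChartedSpace (EuclideanSpace ℝ (Fin d)) N] [IsManifold (𝓡 d) ∞ N]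
    {M : Type*} [TopologicalSpace M] [ChartedSpace (EuclideanSpace ℝ (Fin m)) M]
    (i : M → N) (k : ℕ) (F : FibreFamily d i) : Prop :=
  ∀ p : M, ∃ (U : Set M) (s : Fin k → FieldAlong d i), p ∈ U ∧ IsFrameOn m i F U s

/-- The vector field `di(X)` along `i`. -/
def pushField (i : M → N) (X : ∀ p : M, TangentSpace (𝓡 m) p) : FieldAlong d i :=
  fun p ↦ mfderiv (𝓡 m) (𝓡 d) i p (X p)

/-- The pullback to `i^* TN` of an affine connection of `N`: the derivative at `p`, in the
direction `v ∈ T_p M`, of a vector field `Z` along `i`. In the local frame `(e_a)` of `TN` given by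
the preferred chart at `i p`, if `Z = ∑ z^a (e_a ∘ i)` then this is
`∑ dz^a(v) e_a(i p) + ∑ z^a(p) ∇_{di(v)} e_a`. -/
def covAlong (nabla : AffineConnection d N) (i : M → N) (Z : FieldAlong d i) (p : M)
    (v : TangentSpace (𝓡 m) p) : TangentSpace (𝓡 d) (i p) :=
  (trivializationAt (EuclideanSpace ℝ (Fin d)) (TangentSpace (𝓡 d)) (i p)).symm (i p)
      (mfderiv (𝓡 m) 𝓘(ℝ, EuclideanSpace ℝ (Fin d))
        (fun q ↦ ((trivializationAt (EuclideanSpace ℝ (Fin d)) (TangentSpace (𝓡 d)) (i p))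
          ⟨i q, Z q⟩).2) p v)
    + nabla (FiberBundle.extend (EuclideanSpace ℝ (Fin d)) (Z p)) (i p)
        (mfderiv (𝓡 m) (𝓡 d) i p v)

/-! ## Lightlike submanifolds -/

/-- `T_p M`, as a subspace of `T_{i p} N`. -/
def tangentFam (m : ℕ) {d : ℕ} {N : Type*} [TopologicalSpace N]
    [ChartedSpace (EuclideanSpace ℝ (Fin d)) N]
    {M : Type*} [TopologicalSpace M] [ChartedSpace (EuclideanSpace ℝ (Fin m)) M]
    (i : M → N) : FibreFamily d i :=
  fun p ↦ LinearMap.range (mfderiv (𝓡 m) (𝓡 d) i p).toLinearMap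

/-- The orthogonal complement of `F` in `i^* TN`. -/
def SemiRiemannianMetric.perp (g : SemiRiemannianMetric d N) {i : M → N} (F : FibreFamily d i) :
    FibreFamily d i :=
  fun p ↦ (g.val (i p)).toBilinForm.orthogonal (F p)

/-- `Rad(TM) = TM ∩ TM^⊥`. -/
def SemiRiemannianMetric.rad (m : ℕ) {M : Type*} [TopologicalSpace M]
    [ChartedSpace (EuclideanSpace ℝ (Fin m)) M] (g : SemiRiemannianMetric d N) (i : M → N) :
    FibreFamily d i :=
  tangentFam m i ⊓ g.perp (tangentFam m i)

/-- The structure of a lightlike submanifold `(M, S(TM), S(TM^⊥))`, immersed by `i` in `(N, g)`,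
together with a lightlike transversal vector bundle `ltr(TM)`. -/
structure LightlikeSubmanifold (m : ℕ) {M : Type*} [TopologicalSpace M]
    [ChartedSpace (EuclideanSpace ℝ (Fin m)) M] [IsManifold (𝓡 m) ∞ M]
    (g : SemiRiemannianMetric d N) (i : M → N) where
  immersion : Manifold.IsImmersion (𝓡 m) (𝓡 d) ∞ i
  /-- the rank of the radical distribution -/
  r : ℕ
  one_le_r : 1 ≤ r
  r_le : r ≤ m
  rad_subbundle : IsSubbundle m i r (g.rad m i)
  /-- the screen distribution `S(TM)` -/
  screen : FibreFamily d i
  screen_subbundle : ∃ k, IsSubbundle m i k screen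
  screen_disjoint : ∀ p, Disjoint (g.rad m i p) (screen p)
  screen_sup : ∀ p, g.rad m i p ⊔ screen p = tangentFam m i p
  /-- the screen transversal vector bundle `S(TM^⊥)` -/
  screenTr : FibreFamily d i
  screenTr_subbundle : ∃ k, IsSubbundle m i k screenTr
  screenTr_disjoint : ∀ p, Disjoint (g.rad m i p) (screenTr p)
  screenTr_sup : ∀ p, g.rad m i p ⊔ screenTr p = g.perp (tangentFam m i) p
  /-- the lightlike transversal vector bundle `ltr(TM)` -/
  ltr : FibreFamily d i
  ltr_subbundle : IsSubbundle m i r ltr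
  /-- `ltr(TM)` lies in the orthogonal complement of `S(TM^⊥)` in `S(TM)^⊥` -/
  ltr_le : ∀ p, ltr p ≤ g.perp screen p ⊓ g.perp screenTr p
  /-- for any local frame `ξ` of `Rad(TM)` there is a local frame `η` of `ltr(TM)` with
  `g(ξ_j, η_k) = δ_{jk}` and `g(η_j, η_k) = 0` -/
  ltr_dual : ∀ (U : Set M) (ξ : Fin r → FieldAlong d i), IsFrameOn m i (g.rad m i) U ξ →
    ∃ η : Fin r → FieldAlong d i, IsFrameOn m i ltr U η ∧ ∀ p ∈ U, ∀ j k,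
      g.val (i p) (ξ j p) (η k p) = (if j = k then 1 else 0) ∧
        g.val (i p) (η j p) (η k p) = 0

theorem IsSubbundle.finrank_eq {m d : ℕ} {N : Type*} [TopologicalSpace N]
    [ChartedSpace (EuclideanSpace ℝ (Fin d)) N] [IsManifold (𝓡 d) ∞ N]
    {M : Type*} [TopologicalSpace M] [ChartedSpace (EuclideanSpace ℝ (Fin m)) M] {i : M → N} {k : ℕ} {F : FibreFamily d i}
    (h : IsSubbundle m i k F) (p : M) : Module.finrank ℝ (F p) = k := by
  obtain ⟨U, s, hp, hs⟩ := h p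
  rw [← hs.span_eq p hp, finrank_span_eq_card (hs.linearIndependent p hp), Fintype.card_fin]

/-- If `R = T ∩ T^⊥`, `T^⊥ = R ⊕ W` and `P` is in duality with `R`, then `V = T ⊕ P ⊕ W`. -/
theorem isCompl_of_lightlike {V : Type*} [AddCommGroup V] [Module ℝ V] [FiniteDimensional ℝ V]
    {B : LinearMap.BilinForm ℝ V} (hB : B.Nondegenerate)
    (hsymm : ∀ u v, B u v = B v u) {T R W P : Submodule ℝ V}
    (hR : R = T ⊓ B.orthogonal T) (hd : Disjoint R W) (hs : R ⊔ W = B.orthogonal T)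
    (hr : Module.finrank ℝ P = Module.finrank ℝ R)
    (hP : ∀ x ∈ P, (∀ ξ ∈ R, B ξ x = 0) → x = 0) :
    IsCompl T (P ⊔ W) ∧ IsCompl P (T ⊔ W) ∧ IsCompl W (T ⊔ P) := by
  have hTW : Disjoint T W := by
    rw [Submodule.disjoint_def]
    intro x hxT hxW
    refine Submodule.disjoint_def.1 hd x ?_ hxW
    rw [hR]
    exact ⟨hxT, hs ▸ (le_sup_right : W ≤ R ⊔ W) hxW⟩
  have hPTW : Disjoint P (T ⊔ W) := by
    rw [Submodule.disjoint_def]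
    intro x hxP hx
    refine hP x hxP fun ξ hξ ↦ ?_
    obtain ⟨t, ht, w, hw, rfl⟩ := Submodule.mem_sup.1 hx
    have hξ' : ξ ∈ T ⊓ B.orthogonal T := hR ▸ hξ
    have hw' : w ∈ B.orthogonal T := hs ▸ (le_sup_right : W ≤ R ⊔ W) hw
    rw [map_add, hsymm ξ t, hξ'.2 t ht, hw' ξ hξ'.1, add_zero]
  have htop : P ⊔ (T ⊔ W) = ⊤ := by
    apply Submodule.eq_top_of_finrank_eq
    have h1 := Submodule.finrank_sup_add_finrank_inf_eq P (T ⊔ W)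
    have h2 := Submodule.finrank_sup_add_finrank_inf_eq T W
    have h3 := Submodule.finrank_sup_add_finrank_inf_eq R W
    have h4 := LinearMap.BilinForm.finrank_orthogonal hB T
    have h5 := Submodule.finrank_le T
    rw [hPTW.eq_bot, finrank_bot] at h1
    rw [hTW.eq_bot, finrank_bot] at h2
    rw [hd.eq_bot, finrank_bot, hs] at h3
    omega
  refine ⟨⟨?_, ?_⟩, ⟨hPTW, codisjoint_iff.2 htop⟩, ⟨?_, ?_⟩⟩
  · rw [sup_comm]
    exact hTW.disjoint_sup_right_of_disjoint_sup_left hPTW.symm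
  · rw [codisjoint_iff, ← htop, sup_left_comm]
  · exact hTW.symm.disjoint_sup_right_of_disjoint_sup_left (by rw [sup_comm]; exact hPTW.symm)
  · rw [codisjoint_iff, ← htop, sup_comm, sup_comm T P, sup_assoc]

namespace LightlikeSubmanifold

variable {g : SemiRiemannianMetric d N} {i : M → N} (L : LightlikeSubmanifold m g i)

/-- `TN|_M = TM ⊕ ltr(TM) ⊕ S(TM^⊥)`. -/
theorem isCompl (p : M) :
    IsCompl (tangentFam m i p) (L.ltr p ⊔ L.screenTr p) ∧
      IsCompl (L.ltr p) (tangentFam m i p ⊔ L.screenTr p) ∧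
        IsCompl (L.screenTr p) (tangentFam m i p ⊔ L.ltr p) := by
  have : FiniteDimensional ℝ (TangentSpace (𝓡 d) (i p)) :=
    inferInstanceAs (FiniteDimensional ℝ (EuclideanSpace ℝ (Fin d)))
  refine isCompl_of_lightlike (B := (g.val (i p)).toBilinForm) ?_ (g.symm (i p)) rfl
    (L.screenTr_disjoint p) (L.screenTr_sup p)
    ((L.ltr_subbundle.finrank_eq p).trans (L.rad_subbundle.finrank_eq p).symm) ?_
  · refine ⟨fun u hu ↦ g.nondegenerate _ u hu, fun u hu ↦ g.nondegenerate _ u fun v ↦ ?_⟩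
    rw [g.symm]
    exact hu v
  · intro x hx h
    obtain ⟨U, ξ, hp, hξ⟩ := L.rad_subbundle p
    obtain ⟨η, hη, hdual⟩ := L.ltr_dual U ξ hξ
    rw [← hη.span_eq p hp] at hx
    obtain ⟨c, rfl⟩ := (Submodule.mem_span_range_iff_exists_fun ℝ).1 hx
    refine Finset.sum_eq_zero fun j _ ↦ ?_
    have hmem : ξ j p ∈ g.rad m i p := by
      rw [← hξ.span_eq p hp]
      exact Submodule.subset_span ⟨j, rfl⟩
    have h0 := h (ξ j p) hmem
    have hc : c j = 0 := by
      simpa [map_sum, (hdual p hp j _).1] using h0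
    rw [hc, zero_smul]

/-- The projection of `TN|_M = TM ⊕ ltr(TM) ⊕ S(TM^⊥)` onto `TM`. -/
def projTangent (p : M) : TangentSpace (𝓡 d) (i p) →ₗ[ℝ] TangentSpace (𝓡 d) (i p) :=
  Submodule.projection _ _ (L.isCompl p).1

/-- The projection of `TN|_M = TM ⊕ ltr(TM) ⊕ S(TM^⊥)` onto `ltr(TM)`. -/
def projLtr (p : M) : TangentSpace (𝓡 d) (i p) →ₗ[ℝ] TangentSpace (𝓡 d) (i p) :=
  Submodule.projection _ _ (L.isCompl p).2.1

/-- The projection of `TN|_M = TM ⊕ ltr(TM) ⊕ S(TM^⊥)` onto `S(TM^⊥)`. -/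
def projScreenTr (p : M) : TangentSpace (𝓡 d) (i p) →ₗ[ℝ] TangentSpace (𝓡 d) (i p) :=
  Submodule.projection _ _ (L.isCompl p).2.2

/-! The Gauss formula `∇_X Y = (induced connection) + h^l(X, Y) + h^s(X, Y)` for an arbitrary affine
connection `nabla` of `N`, where `X` is a vector field on `M` and `Y` is a section of `TM ⊆ i^* TN`.
-/

/-- The connection on `M` induced by `nabla`. -/
def induced (nabla : AffineConnection d N) (X : ∀ p : M, TangentSpace (𝓡 m) p)
    (Y : FieldAlong d i) : FieldAlong d i :=
  fun p ↦ L.projTangent p (covAlong nabla i Y p (X p))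

/-- The lightlike second fundamental form `h^l` of `nabla`. -/
def hl (nabla : AffineConnection d N) (X : ∀ p : M, TangentSpace (𝓡 m) p)
    (Y : FieldAlong d i) : FieldAlong d i :=
  fun p ↦ L.projLtr p (covAlong nabla i Y p (X p))

/-- The screen second fundamental form `h^s` of `nabla`. -/
def hs (nabla : AffineConnection d N) (X : ∀ p : M, TangentSpace (𝓡 m) p)
    (Y : FieldAlong d i) : FieldAlong d i :=
  fun p ↦ L.projScreenTr p (covAlong nabla i Y p (X p))

end LightlikeSubmanifold

/-- The vector field `X` on `M` is smooth and belongs to `Γ(F)`, for a distribution `F ⊆ TM`. -/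
def IsTangentSection (i : M → N) (F : FibreFamily d i) (X : ∀ p : M, TangentSpace (𝓡 m) p) :
    Prop :=
  ContMDiff (𝓡 m) ((𝓡 m).prod 𝓘(ℝ, EuclideanSpace ℝ (Fin m))) ∞
    (fun p ↦ (⟨p, X p⟩ : TangentBundle (𝓡 m) M)) ∧ ∀ p, pushField i X p ∈ F p

/-- The distribution `F ⊆ TM` is a foliation, i.e. it is involutive. -/
def IsFoliation (m : ℕ) {d : ℕ} {N : Type*} [TopologicalSpace N]
    [ChartedSpace (EuclideanSpace ℝ (Fin d)) N] [IsManifold (𝓡 d) ∞ N]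
    {M : Type*} [TopologicalSpace M] [ChartedSpace (EuclideanSpace ℝ (Fin m)) M]
    [IsManifold (𝓡 m) ∞ M] (i : M → N) (F : FibreFamily d i) : Prop :=
  ∀ X Y : ∀ p : M, TangentSpace (𝓡 m) p, IsTangentSection i F X → IsTangentSection i F Y →
    ∀ p, pushField i (VectorField.mlieBracket (𝓡 m) X Y) p ∈ F p

/-- The distribution `F ⊆ TM` defines a totally geodesic foliation in `M`: it is involutive, and
`∇_X Y ∈ Γ(F)` for all `X, Y ∈ Γ(F)`, where `∇` is the connection on `M` induced by `hatNabla`. -/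
def LightlikeSubmanifold.IsTotallyGeodesicFoliation {g : SemiRiemannianMetric d N} {i : M → N}
    (L : LightlikeSubmanifold m g i) (hatNabla : AffineConnection d N) (F : FibreFamily d i) :
    Prop :=
  IsFoliation m i F ∧
    ∀ (X : ∀ p : M, TangentSpace (𝓡 m) p) (Y : FieldAlong d i),
      IsTangentSection i F X → IsSection m i F Y → ∀ p, L.induced hatNabla X Y p ∈ F p

/-! ## Contact CR-lightlike submanifolds -/

/-- The image `φ(F)`. -/
def AlmostContactMetric.map {g : SemiRiemannianMetric d N} (A : AlmostContactMetric g) {i : M → N}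
    (F : FibreFamily d i) : FibreFamily d i :=
  fun p ↦ (F p).map (A.φ (i p)).toLinearMap

/-- The vector field `φ Z` along `i`. -/
def AlmostContactMetric.apply {g : SemiRiemannianMetric d N} (A : AlmostContactMetric g) {i : M → N}
    (Z : FieldAlong d i) : FieldAlong d i :=
  fun p ↦ A.φ (i p) (Z p)

/-- The family `{ν}` of lines spanned by the structure vector field. -/
def AlmostContactMetric.lineν {g : SemiRiemannianMetric d N} (A : AlmostContactMetric g)
    (i : M → N) : FibreFamily d i :=
  fun p ↦ Submodule.span ℝ {A.ν (i p)}

/-- The structure of a contact CR-lightlike submanifold on the lightlike submanifold `L`. -/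
structure ContactCRLightlike {g : SemiRiemannianMetric d N} (A : AlmostContactMetric g) {i : M → N}
    (L : LightlikeSubmanifold m g i) where
  ν_tangent : ∀ p, A.ν (i p) ∈ tangentFam m i p
  rad_disjoint : ∀ p, Disjoint (g.rad m i p) (A.map (g.rad m i) p)
  /-- the bundle `D_0` -/
  D₀ : FibreFamily d i
  D₀_subbundle : ∃ k, IsSubbundle m i k D₀
  /-- the bundle `D'` -/
  D' : FibreFamily d i
  D'_subbundle : ∃ k, IsSubbundle m i k D'
  /-- the bundle `L_1 ⊆ S(TM^⊥)` -/
  L₁ : FibreFamily d i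
  L₁_subbundle : ∃ k, IsSubbundle m i k L₁
  L₁_le : ∀ p, L₁ p ≤ L.screenTr p
  /-- `S(TM) = (φ(Rad(TM)) ⊕ D') ⊥ D_0 ⊥ {ν}` -/
  screen_eq : ∀ p, A.map (g.rad m i) p ⊔ D' p ⊔ D₀ p ⊔ A.lineν i p = L.screen p
  disjoint_D' : ∀ p, Disjoint (A.map (g.rad m i) p) (D' p)
  disjoint_D₀ : ∀ p, Disjoint (A.map (g.rad m i) p ⊔ D' p) (D₀ p)
  disjoint_ν : ∀ p, Disjoint (A.map (g.rad m i) p ⊔ D' p ⊔ D₀ p) (A.lineν i p)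
  orthogonal_D₀ : ∀ p, D₀ p ≤ g.perp (A.map (g.rad m i) ⊔ D') p
  orthogonal_ν : ∀ p, A.lineν i p ≤ g.perp (A.map (g.rad m i) ⊔ D' ⊔ D₀) p
  /-- `D_0` is `φ`-invariant and non-degenerate -/
  map_D₀ : ∀ p, A.map D₀ p = D₀ p
  D₀_nondegenerate : ∀ p, Disjoint (D₀ p) (g.perp D₀ p)
  /-- `φ(D') = L_1 ⊥ ltr(TM)` -/
  map_D' : ∀ p, A.map D' p = L₁ p ⊔ L.ltr p
  disjoint_L₁ : ∀ p, Disjoint (L₁ p) (L.ltr p)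
  orthogonal_L₁ : ∀ p, L₁ p ≤ g.perp L.ltr p

/-- The distribution `D ⊥ {ν}`, where `D = Rad(TM) ⊥ φ(Rad(TM)) ⊥ D_0`. -/
def ContactCRLightlike.Dν {g : SemiRiemannianMetric d N} {A : AlmostContactMetric g} {i : M → N}
    {L : LightlikeSubmanifold m g i} (C : ContactCRLightlike A L) : FibreFamily d i :=
  g.rad m i ⊔ A.map (g.rad m i) ⊔ C.D₀ ⊔ A.lineν i

end Along

end

/-! Everything reduces to the Levi-Civita connection. Write ∇, ∇* and ∇^ for the statistical, dual
and Levi-Civita connections. The difference K = ∇ − ∇^ is symmetric because both connections are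
torsion-free, and the Codazzi condition makes g(K(X, Y), Z) symmetric in Y and Z. Hence ∇* = ∇^ − K
and ∇ + ∇* = 2∇^ (`add_dual_eq`). Since Rad(TM) sees only the ltr(TM) component and S(TM^⊥) only its
own, the two sums of second fundamental forms are 2g(∇^_X φY, ξ) and 2g(∇^_X Y, φW).

Membership in D ⊥ {ν} is tested by orthogonality. TM = (D ⊥ {ν}) + D', φ(D') = L₁ ⊥ ltr(TM), ltr(TM)
is dual to Rad(TM), and L₁ is non-degenerate. So the tangent part of u lies in D ⊥ {ν} exactly when
u is orthogonal to φ(Rad(TM)) and φ(L₁) (`projTangent_mem_Dν_iff`).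

The Kenmotsu identity puts (∇^_X φ)Y in the span of φX and ν, so φ can be moved across the metric:
g(∇^_X φY, ξ) = −g(∇^_X Y, φξ), and g(∇^_X Y, l) = g(∇^_X φY, φl) for l in L₁. As D ⊥ {ν} is
φ-invariant, Y may be replaced by φY, and the stated conditions become the orthogonality test for
∇^_X Y. Involutivity then follows because ∇^ is torsion-free.

All of this takes place along the immersion, so the identities on N are first carried over to
`covAlong`, in chart coordinates. -/

/-! ### The Lie bracket as a commutator of derivations. -/

section LieBracket

variable {E : Type*} [NormedAddCommGroup E] [NormedSpace ℝ E]
  {M : Type*} [TopologicalSpace M] [ChartedSpace E M] [IsManifold 𝓘(ℝ, E) ∞ M]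
  {F : Type*} [NormedAddCommGroup F] [NormedSpace ℝ F]

open VectorField

/-- The derivative of a function along a vector field, read in the chart at `p`. -/
theorem mvfderiv_eq_fderiv_mpullbackWithin {X : ∀ q : M, TangentSpace 𝓘(ℝ, E) q} {f : M → F}
    (p : M) {q : M} {y : E} (hy : y ∈ (extChartAt 𝓘(ℝ, E) p).target)
    (hq : q = (extChartAt 𝓘(ℝ, E) p).symm y)
    (hf : MDifferentiableAt 𝓘(ℝ, E) 𝓘(ℝ, F) f q) :
    mvfderiv 𝓘(ℝ, E) f q (X q) =
      fderiv ℝ (f ∘ (extChartAt 𝓘(ℝ, E) p).symm) y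
        (mpullbackWithin 𝓘(ℝ, E) 𝓘(ℝ, E) (extChartAt 𝓘(ℝ, E) p).symm X (range 𝓘(ℝ, E)) y) := by
  have : IsManifold 𝓘(ℝ, E) 1 M := IsManifold.of_le (n := ∞) (by exact_mod_cast le_top)
  subst hq
  have hA := isInvertible_mfderivWithin_extChartAt_symm (I := 𝓘(ℝ, E)) (x := p) hy
  have hd := mdifferentiableWithinAt_extChartAt_symm (I := 𝓘(ℝ, E)) (x := p) hy
  rw [mpullbackWithin_apply]
  simp only [modelWithCornersSelf_coe, range_id, mfderivWithin_univ,
    mdifferentiableWithinAt_univ] at hA hd ⊢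
  rw [← mfderiv_eq_fderiv, mfderiv_comp y hf hd]
  -- The pullback of X carries the inverse of the derivative of the inverse chart, which cancels the
  -- factor produced by the chain rule.
  obtain ⟨A, hA⟩ := hA
  rw [← hA]
  simp only [ContinuousLinearMap.inverse_equiv]
  exact congrArg (mfderiv 𝓘(ℝ, E) 𝓘(ℝ, F) f _) (A.apply_symm_apply _).symm

/-- `d_X (d_Y f) - d_Y (d_X f) = d_{[X, Y]} f`. -/
theorem mvfderiv_mlieBracket [CompleteSpace E] {X Y : ∀ q : M, TangentSpace 𝓘(ℝ, E) q} {f : M → F}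
    {p : M} (hf : ContMDiffAt 𝓘(ℝ, E) 𝓘(ℝ, F) 2 f p)
    (hX : MDifferentiableAt 𝓘(ℝ, E) (𝓘(ℝ, E).prod 𝓘(ℝ, E))
      (fun q ↦ (⟨q, X q⟩ : TangentBundle 𝓘(ℝ, E) M)) p)
    (hY : MDifferentiableAt 𝓘(ℝ, E) (𝓘(ℝ, E).prod 𝓘(ℝ, E))
      (fun q ↦ (⟨q, Y q⟩ : TangentBundle 𝓘(ℝ, E) M)) p) :
    mvfderiv 𝓘(ℝ, E) (fun q ↦ mvfderiv 𝓘(ℝ, E) f q (Y q)) p (X p)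
      - mvfderiv 𝓘(ℝ, E) (fun q ↦ mvfderiv 𝓘(ℝ, E) f q (X q)) p (Y p)
      = mvfderiv 𝓘(ℝ, E) f p (mlieBracket 𝓘(ℝ, E) X Y p) := by
  have : IsManifold 𝓘(ℝ, E) 2 M := inferInstance
  have : IsManifold 𝓘(ℝ, E) 1 M := inferInstance
  set ψ := extChartAt 𝓘(ℝ, E) p with hψ
  set h : E → F := f ∘ ψ.symm with hh
  have htarget : ψ.target ∈ 𝓝 (ψ p) := extChartAt_target_mem_nhds p
  have hp : ψ p ∈ ψ.target := mem_extChartAt_target p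
  have hpp : p = ψ.symm (ψ p) := (extChartAt_to_inv p).symm
  have hsm : ContMDiffAt 𝓘(ℝ, E) 𝓘(ℝ, E) 2 ψ.symm (ψ p) := by
    have := contMDiffOn_extChartAt_symm (I := 𝓘(ℝ, E)) (n := 2) p
    exact (this _ hp).contMDiffAt htarget
  have hhc : ContDiffAt ℝ 2 h (ψ p) := by
    rw [← contMDiffAt_iff_contDiffAt]
    exact ContMDiffAt.comp (ψ p) (hpp ▸ hf) hsm
  have hev : ∀ᶠ y in 𝓝 (ψ p), MDifferentiableAt 𝓘(ℝ, E) 𝓘(ℝ, F) f (ψ.symm y) := by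
    have : ∀ᶠ q in 𝓝 (ψ.symm (ψ p)), MDifferentiableAt 𝓘(ℝ, E) 𝓘(ℝ, F) f q := by
      rw [← hpp]
      filter_upwards [(contMDiffAt_iff_contMDiffAt_nhds (by simp)).1 hf] with q hq
        using hq.mdifferentiableAt (by simp)
    exact hsm.continuousAt.eventually this
  -- In the chart, a second derivative along fields splits into D²h(V', V), which is symmetric and
  -- will cancel, and Dh(DV · V'), whose antisymmetrization is Dh of the bracket.
  have key : ∀ Z Z' : ∀ q : M, TangentSpace 𝓘(ℝ, E) q,
      MDifferentiableAt 𝓘(ℝ, E) (𝓘(ℝ, E).prod 𝓘(ℝ, E))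
        (fun q ↦ (⟨q, Z q⟩ : TangentBundle 𝓘(ℝ, E) M)) p →
      ∀ V V' : E → E, V = mpullbackWithin 𝓘(ℝ, E) 𝓘(ℝ, E) ψ.symm Z (range 𝓘(ℝ, E)) →
        V' = mpullbackWithin 𝓘(ℝ, E) 𝓘(ℝ, E) ψ.symm Z' (range 𝓘(ℝ, E)) →
      mvfderiv 𝓘(ℝ, E) (fun q ↦ mvfderiv 𝓘(ℝ, E) f q (Z q)) p (Z' p) =
        fderiv ℝ (fderiv ℝ h) (ψ p) (V' (ψ p)) (V (ψ p))
          + fderiv ℝ h (ψ p) (fderiv ℝ V (ψ p) (V' (ψ p))) := by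
    intro Z Z' hZ V V' hV hV'
    have hVd : DifferentiableAt ℝ V (ψ p) := by
      have := hZ.mdifferentiableWithinAt (s := univ)
        |>.differentiableWithinAt_mpullbackWithin_vectorField
      rw [← hψ, ← hV] at this
      rw [modelWithCornersSelf_coe, range_id, preimage_univ, inter_univ] at this
      exact differentiableWithinAt_univ.1 this
    have hd2 : DifferentiableAt ℝ (fderiv ℝ h) (ψ p) :=
      (hhc.fderiv_right (m := 1) (by norm_num)).differentiableAt (by simp)
    set G : M → F := fun q ↦ mvfderiv 𝓘(ℝ, E) f q (Z q) with hG
    have hGev : G ∘ ψ.symm =ᶠ[𝓝 (ψ p)] fun y ↦ fderiv ℝ h y (V y) := by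
      filter_upwards [hev, htarget] with y hy hyt
      rw [hV]
      exact mvfderiv_eq_fderiv_mpullbackWithin p hyt rfl hy
    have hGd : MDifferentiableAt 𝓘(ℝ, E) 𝓘(ℝ, F) G p := by
      have h1 : DifferentiableAt ℝ (G ∘ ψ.symm) (ψ p) :=
        (hd2.clm_apply hVd).congr_of_eventuallyEq hGev
      have h2 : MDifferentiableAt 𝓘(ℝ, E) 𝓘(ℝ, F) ((G ∘ ψ.symm) ∘ ψ) p :=
        MDifferentiableAt.comp p h1.mdifferentiableAt
          (mdifferentiableAt_extChartAt (mem_chart_source _ p))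
      refine h2.congr_of_eventuallyEq ?_
      filter_upwards [extChartAt_source_mem_nhds (I := 𝓘(ℝ, E)) p] with q hq
      simp only [Function.comp_apply]
      rw [ψ.left_inv hq]
    rw [mvfderiv_eq_fderiv_mpullbackWithin p hp hpp hGd, ← hψ, ← hV', hGev.fderiv_eq,
      fderiv_clm_apply hd2 hVd]
    simp [add_comm]
  rw [key Y X hY _ _ rfl rfl, key X Y hX _ _ rfl rfl]
  have hfd : MDifferentiableAt 𝓘(ℝ, E) 𝓘(ℝ, F) f p := hf.mdifferentiableAt (by simp)
  set V : E → E := mpullbackWithin 𝓘(ℝ, E) 𝓘(ℝ, E) ψ.symm X (range 𝓘(ℝ, E)) with hV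
  set W : E → E := mpullbackWithin 𝓘(ℝ, E) 𝓘(ℝ, E) ψ.symm Y (range 𝓘(ℝ, E)) with hW
  have hbr : mlieBracket 𝓘(ℝ, E) X Y p = lieBracket ℝ V W (ψ p) := by
    rw [← mlieBracketWithin_univ, mlieBracketWithin_apply]
    rw [modelWithCornersSelf_coe, preimage_univ, range_id, inter_univ]
    -- The tangent space at p is identified with E through this very chart, so the inverse occurring
    -- in the definition of the bracket is the identity.
    have hid : (mfderiv 𝓘(ℝ, E) 𝓘(ℝ, E) (extChartAt 𝓘(ℝ, E) p) p : E →L[ℝ] E) =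
      ContinuousLinearMap.id ℝ E := mfderiv_extChartAt_self
    have hVW : lieBracketWithin ℝ V W univ (ψ p) = lieBracket ℝ V W (ψ p) := by
      rw [lieBracketWithin_univ]
    rw [modelWithCornersSelf_coe, range_id] at hV hW
    rw [hV, hW] at hVW ⊢
    refine (congrArg (fun A : E →L[ℝ] E ↦ A.inverse _) hid).trans ?_
    rw [ContinuousLinearMap.inverse_id]
    exact hVW
  have hsymm : IsSymmSndFDerivAt ℝ h (ψ p) := hhc.isSymmSndFDerivAt (by simp)
  have hdf : ∀ v, mvfderiv 𝓘(ℝ, E) f p v = fderiv ℝ h (ψ p) v := by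
    intro v
    rw [hfd.mvfderiv]
    simp only [writtenInExtChartAt, extChartAt_model_space_eq_id, PartialEquiv.refl_coe,
      Function.id_comp, modelWithCornersSelf_coe, range_id, fderivWithin_univ, hh, hψ]
    rfl
  rw [hdf, hbr, lieBracket, hsymm.eq (V (ψ p)) (W (ψ p)), map_sub]
  abel

end LieBracket

/-! ### Local formulas for connections, and ∇ + ∇* = 2∇^. -/

section Connections

variable {d m : ℕ} {N : Type*} [TopologicalSpace N] [ChartedSpace (EuclideanSpace ℝ (Fin d)) N]
  [IsManifold (𝓡 d) ∞ N]
  {M : Type*} [TopologicalSpace M] [ChartedSpace (EuclideanSpace ℝ (Fin m)) M]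

theorem mvfderiv_congr {E : Type*} [NormedAddCommGroup E] [NormedSpace ℝ E] {f g : M → E} {p : M}
    (h : f =ᶠ[𝓝 p] g) : mvfderiv (𝓡 m) f p = mvfderiv (𝓡 m) g p := by
  ext v
  exact DFunLike.congr_fun h.mfderiv_eq v

/-- The coordinates of `w ∈ T_y N` with respect to the preferred chart at `x`. -/
noncomputable abbrev tangentCoord (x y : N) : TangentSpace (𝓡 d) y →L[ℝ] EuclideanSpace ℝ (Fin d) :=
  (trivializationAt (EuclideanSpace ℝ (Fin d)) (TangentSpace (𝓡 d)) x).continuousLinearMapAt ℝ y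

/-- The vector of `T_y N` with given coordinates with respect to the preferred chart at `x`. -/
noncomputable abbrev tangentCoordSymm (x y : N) :
    EuclideanSpace ℝ (Fin d) →L[ℝ] TangentSpace (𝓡 d) y :=
  (trivializationAt (EuclideanSpace ℝ (Fin d)) (TangentSpace (𝓡 d)) x).symmL ℝ y

theorem mem_baseSet_self (x : N) :
    x ∈ (trivializationAt (EuclideanSpace ℝ (Fin d)) (TangentSpace (𝓡 d)) x).baseSet :=
  FiberBundle.mem_baseSet_trivializationAt' x

theorem tangentCoord_apply {x y : N}
    (hy : y ∈ (trivializationAt (EuclideanSpace ℝ (Fin d)) (TangentSpace (𝓡 d)) x).baseSet)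
    (w : TangentSpace (𝓡 d) y) :
    tangentCoord x y w =
      (trivializationAt (EuclideanSpace ℝ (Fin d)) (TangentSpace (𝓡 d)) x ⟨y, w⟩).2 := by
  rw [tangentCoord, Trivialization.continuousLinearMapAt_apply, Trivialization.linearMapAt_apply,
    if_pos hy]

theorem tangentCoordSymm_tangentCoord (x : N) (w : TangentSpace (𝓡 d) x) :
    tangentCoordSymm x x (tangentCoord x x w) = w :=
  Trivialization.symmL_continuousLinearMapAt _ (mem_baseSet_self x) w

theorem isDiffField_extend (x : N) (w : TangentSpace (𝓡 d) x) :
    IsDiffField d (FiberBundle.extend (EuclideanSpace ℝ (Fin d)) w) x :=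
  FiberBundle.mdifferentiableAt_extend ..

theorem tangentCoord_extend {x y : N}
    (hy : y ∈ (trivializationAt (EuclideanSpace ℝ (Fin d)) (TangentSpace (𝓡 d)) x).baseSet)
    (w : TangentSpace (𝓡 d) x) :
    tangentCoord x y (FiberBundle.extend (EuclideanSpace ℝ (Fin d)) w y) = tangentCoord x x w := by
  rw [tangentCoord_apply hy, tangentCoord_apply (mem_baseSet_self x), FiberBundle.extend,
    Trivialization.apply_mk_symm _ hy]

theorem eventually_tangentCoord {f : M → N} {p : M} (hf : ContinuousAt f p)
    (Z : FieldAlong d f) :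
    (fun q ↦ tangentCoord (f p) (f q) (Z q)) =ᶠ[𝓝 p] fun q ↦
      (trivializationAt (EuclideanSpace ℝ (Fin d)) (TangentSpace (𝓡 d)) (f p) ⟨f q, Z q⟩).2 := by
  filter_upwards [hf.eventually ((trivializationAt (EuclideanSpace ℝ (Fin d))
    (TangentSpace (𝓡 d)) (f p)).open_baseSet.mem_nhds (mem_baseSet_self (f p)))] with q hq
    using tangentCoord_apply hq _

/-- `Z` is differentiable at `p` as a vector field along `f`. -/
abbrev IsDiffAlong (m : ℕ) {d : ℕ} {N : Type*} [TopologicalSpace N]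
    [ChartedSpace (EuclideanSpace ℝ (Fin d)) N] [IsManifold (𝓡 d) ∞ N]
    {M : Type*} [TopologicalSpace M] [ChartedSpace (EuclideanSpace ℝ (Fin m)) M]
    (f : M → N) (Z : FieldAlong d f) (p : M) : Prop :=
  MDifferentiableAt (𝓡 m) ((𝓡 d).prod 𝓘(ℝ, EuclideanSpace ℝ (Fin d)))
    (fun q ↦ (⟨f q, Z q⟩ : TangentBundle (𝓡 d) N)) p

/-- A vector field along `f` is differentiable iff its base map and its coordinates are. -/
theorem isDiffAlong_iff {f : M → N} {Z : FieldAlong d f} {p : M} :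
    IsDiffAlong m f Z p ↔ MDifferentiableAt (𝓡 m) (𝓡 d) f p ∧
      MDifferentiableAt (𝓡 m) 𝓘(ℝ, EuclideanSpace ℝ (Fin d))
        (fun q ↦ tangentCoord (f p) (f q) (Z q)) p := by
  rw [IsDiffAlong, mdifferentiableAt_totalSpace]
  refine and_congr_right fun hf ↦ ?_
  exact (eventually_tangentCoord hf.continuousAt Z).symm.mdifferentiableAt_iff

theorem IsDiffField.coord {V : ∀ y : N, TangentSpace (𝓡 d) y} {x : N} (hV : IsDiffField d V x) :
    MDifferentiableAt (𝓡 d) 𝓘(ℝ, EuclideanSpace ℝ (Fin d))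
      (fun y ↦ tangentCoord x y (V y)) x :=
  (isDiffAlong_iff (f := id).1 hV).2

/-- The derivative of the coordinates of a vector field is a covariant derivative at `x`. -/
theorem isCovariantDerivativeOn_coord (x : N) :
    IsCovariantDerivativeOn (I := 𝓡 d) (EuclideanSpace ℝ (Fin d))
      (V := (TangentSpace (𝓡 d) : N → Type _))
      (fun V y ↦ (tangentCoordSymm x y).comp
        (mvfderiv (𝓡 d) (fun z ↦ tangentCoord x z (V z)) y)) {x} where
  add {V W y} hV hW hy := by
    obtain rfl : y = x := hy
    have h := mvfderiv_fun_add (IsDiffField.coord hV) (IsDiffField.coord hW)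
    simp only [Pi.add_apply, map_add]
    rw [h, ContinuousLinearMap.comp_add]
  leibniz {V g y} hV hg hy := by
    obtain rfl : y = x := hy
    have h := mvfderiv_fun_smul hg (IsDiffField.coord hV)
    simp only [Pi.smul_apply', map_smul]
    rw [h]
    ext1 v
    have h1 := tangentCoordSymm_tangentCoord y (V y)
    simp only [ContinuousLinearMap.comp_apply, _root_.add_apply, map_add,
      _root_.smul_apply, map_smul, ContinuousLinearMap.smulRight_apply, h1]

/-- `FiberBundle.extend` has constant coordinates near x. Such extensions isolate the Christoffel
part of a connection. -/
theorem mvfderiv_tangentCoord_extend {x : N} (w : TangentSpace (𝓡 d) x) :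
    mvfderiv (𝓡 d) (fun y ↦ tangentCoord x y
      (FiberBundle.extend (EuclideanSpace ℝ (Fin d)) w y)) x = 0 := by
  have : (fun y ↦ tangentCoord x y (FiberBundle.extend (EuclideanSpace ℝ (Fin d)) w y)) =ᶠ[𝓝 x]
      fun _ ↦ tangentCoord x x w := by
    filter_upwards [(trivializationAt (EuclideanSpace ℝ (Fin d))
      (TangentSpace (𝓡 d)) x).open_baseSet.mem_nhds (mem_baseSet_self x)] with y hy
      using tangentCoord_extend hy _
  rw [mvfderiv_congr this, mvfderiv_const]

/-- The local formula for a connection. -/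
theorem AffineConnection.eq_coord (nabla : AffineConnection d N) {V : ∀ y : N, TangentSpace (𝓡 d) y}
    {x : N} (hV : IsDiffField d V x) (u : TangentSpace (𝓡 d) x) :
    nabla V x u =
      tangentCoordSymm x x (mvfderiv (𝓡 d) (fun y ↦ tangentCoord x y (V y)) x u)
        + nabla (FiberBundle.extend (EuclideanSpace ℝ (Fin d)) (V x)) x u := by
  set W := FiberBundle.extend (EuclideanSpace ℝ (Fin d)) (V x)
  have hW : IsDiffField d W x := isDiffField_extend x (V x)
  have hWx : W x = V x := FiberBundle.extend_apply_self ..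
  -- The difference of two covariant derivatives is tensorial: at x it depends only on the value of
  -- the field there, so V and W give the same difference. For W the coordinate derivative vanishes.
  have h := (nabla.isCovariantDerivativeOn (s := {x})).difference_apply
    (isCovariantDerivativeOn_coord x) (mem_singleton x) hV
  have h' := (nabla.isCovariantDerivativeOn (s := {x})).difference_apply
    (isCovariantDerivativeOn_coord x) (mem_singleton x) hW
  have hzero : mvfderiv (𝓡 d) (fun y ↦ tangentCoord x y (W y)) x = 0 :=
    mvfderiv_tangentCoord_extend _
  rw [hWx, h] at h'
  have h'' := congr($h' u)
  simp only [hzero, ContinuousLinearMap.comp_zero, sub_zero, _root_.sub_apply,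
    ContinuousLinearMap.comp_apply] at h''
  rw [← h'']
  abel

/-- The local formula for a pullback connection. -/
theorem covAlong_eq (nabla : AffineConnection d N) {f : M → N} {Z : FieldAlong d f} {p : M}
    (hf : ContinuousAt f p) (v : TangentSpace (𝓡 m) p) :
    covAlong nabla f Z p v =
      tangentCoordSymm (f p) (f p)
        (mvfderiv (𝓡 m) (fun q ↦ tangentCoord (f p) (f q) (Z q)) p v)
      + nabla (FiberBundle.extend (EuclideanSpace ℝ (Fin d)) (Z p)) (f p)
        (mfderiv (𝓡 m) (𝓡 d) f p v) := by
  rw [mvfderiv_congr (eventually_tangentCoord hf Z), covAlong, tangentCoordSymm,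
    Trivialization.symmL_apply _ (mem_baseSet_self (f p))]
  rfl


/-- The coordinate derivative is the same for all three connections and occurs twice on each side;
what remains is the relation on N for the extension of Z p. -/
theorem covAlong_add_covAlong {nabla nabla' nabla'' : AffineConnection d N} {f : M → N}
    (h : ∀ (x : N) (Y : ∀ y : N, TangentSpace (𝓡 d) y) (u : TangentSpace (𝓡 d) x),
      IsDiffField d Y x → nabla Y x u + nabla' Y x u = (2 : ℝ) • nabla'' Y x u)
    {Z : FieldAlong d f} {p : M} (hf : ContinuousAt f p) (v : TangentSpace (𝓡 m) p) :
    covAlong nabla f Z p v + covAlong nabla' f Z p v = (2 : ℝ) • covAlong nabla'' f Z p v := by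
  have := h (f p) _ (mfderiv (𝓡 m) (𝓡 d) f p v) (isDiffField_extend (f p) (Z p))
  rw [covAlong_eq _ hf, covAlong_eq _ hf, covAlong_eq _ hf, smul_add, ← this, two_smul]
  abel

/-- `∇ + ∇*` is twice the Levi-Civita connection. -/
theorem add_dual_eq {g : SemiRiemannianMetric d N} {nabla nablaStar hatNabla : AffineConnection d N}
    (hhat : g.IsLeviCivita hatNabla) (hstat : g.IsStatistical nabla)
    (hdual : g.IsDual nabla nablaStar) (x : N) (Y : ∀ y : N, TangentSpace (𝓡 d) y)
    (u : TangentSpace (𝓡 d) x) (hY : IsDiffField d Y x) :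
    nabla Y x u + nablaStar Y x u = (2 : ℝ) • hatNabla Y x u := by
  rw [← sub_eq_zero]
  refine g.nondegenerate x _ fun w ↦ ?_
  set X := FiberBundle.extend (EuclideanSpace ℝ (Fin d)) u
  set Z := FiberBundle.extend (EuclideanSpace ℝ (Fin d)) w
  have hX : IsDiffField d X x := isDiffField_extend x u
  have hZ : IsDiffField d Z x := isDiffField_extend x w
  have hXx : X x = u := FiberBundle.extend_apply_self ..
  have hZx : Z x = w := FiberBundle.extend_apply_self ..
  rw [← hXx, ← hZx]
  -- Both connections are torsion-free, so K = `nabla` − `hatNabla` is symmetric.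
  have symm : ∀ A B : ∀ y : N, TangentSpace (𝓡 d) y, IsDiffField d A x → IsDiffField d B x →
      ∀ w, g.val x w (nabla B x (A x)) - g.val x w (nabla A x (B x)) =
        g.val x w (hatNabla B x (A x)) - g.val x w (hatNabla A x (B x)) := by
    intro A B hA hB w
    rw [← map_sub, ← map_sub, hstat.1 x A B hA hB, hhat.1 x A B hA hB]
  have t1 := symm X Y hX hY (Z x)
  have t2 := symm X Z hX hZ (Y x)
  have t3 := symm Y Z hY hZ (X x)
  -- With metricity of `hatNabla` (`l1`, `l2`) and the symmetry of K, the Codazzi equation `s1`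
  -- reads g(K(X, Y), Z) = g(K(X, Z), Y). Then `l3` and duality `d1` give the claim.
  have l1 := hhat.2 x Y Z X hY hZ hX
  have l2 := hhat.2 x Z Y X hZ hY hX
  have l3 := hhat.2 x X Z Y hX hZ hY
  have s1 := hstat.2 x Y Z X hY hZ hX
  have d1 := hdual x X Z Y hX hZ hY
  simp only [SemiRiemannianMetric.covDeriv] at l1 l2 l3 s1
  have e := g.symm x
  rw [e _ (X x)] at l1 l2
  rw [e _ (Y x)] at l3 d1
  rw [e _ (X x), e _ (X x)] at s1
  rw [e _ (Z x), map_sub, map_add, map_smul, smul_eq_mul]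
  linarith

end Connections

/-! ### The Kenmotsu identity for vector fields along a map. -/

section Kenmotsu

variable {d m : ℕ} {N : Type*} [TopologicalSpace N] [ChartedSpace (EuclideanSpace ℝ (Fin d)) N]
  [IsManifold (𝓡 d) ∞ N]
  {M : Type*} [TopologicalSpace M] [ChartedSpace (EuclideanSpace ℝ (Fin m)) M]

theorem mvfderiv_clm_apply {E F : Type*} [NormedAddCommGroup E] [NormedSpace ℝ E]
    [NormedAddCommGroup F] [NormedSpace ℝ F] {A : M → E →L[ℝ] F} {z : M → E} {p : M}
    (hA : MDifferentiableAt (𝓡 m) 𝓘(ℝ, E →L[ℝ] F) A p)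
    (hz : MDifferentiableAt (𝓡 m) 𝓘(ℝ, E) z p) (v : TangentSpace (𝓡 m) p) :
    mvfderiv (𝓡 m) (fun q ↦ A q (z q)) p v =
      mvfderiv (𝓡 m) A p v (z p) + A p (mvfderiv (𝓡 m) z p v) := by
  have h : HasMFDerivAt (𝓡 m) 𝓘(ℝ, F) (fun q ↦ A q (z q)) p _ :=
    ⟨hA.continuousAt.clm_apply hz.continuousAt,
      hA.hasMFDerivAt.2.clm_apply hz.hasMFDerivAt.2⟩
  have h' := DFunLike.congr_fun h.mfderiv v
  refine h'.trans ?_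
  simp only [writtenInExtChartAt, Function.comp_apply, extChartAt_to_inv]
  exact add_comm _ _

variable {g : SemiRiemannianMetric d N} (A : AlmostContactMetric g)

/-- `φ` in the coordinates of the preferred chart at `x`. -/
noncomputable def AlmostContactMetric.coord (x y : N) :
    EuclideanSpace ℝ (Fin d) →L[ℝ] EuclideanSpace ℝ (Fin d) :=
  (tangentCoord x y).comp ((A.φ y).comp (tangentCoordSymm x y))

theorem AlmostContactMetric.mdifferentiableAt_coord (x : N) :
    MDifferentiableAt (𝓡 d) 𝓘(ℝ, EuclideanSpace ℝ (Fin d) →L[ℝ] EuclideanSpace ℝ (Fin d))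
      (A.coord x) x :=
  (((contMDiffAt_hom_bundle _).1 A.φ_smooth.contMDiffAt).2.mdifferentiableAt (by simp) :)

theorem AlmostContactMetric.tangentCoord_φ {x y : N}
    (hy : y ∈ (trivializationAt (EuclideanSpace ℝ (Fin d)) (TangentSpace (𝓡 d)) x).baseSet)
    (w : TangentSpace (𝓡 d) y) :
    tangentCoord x y (A.φ y w) = A.coord x y (tangentCoord x y w) := by
  have : tangentCoordSymm x y (tangentCoord x y w) = w :=
    Trivialization.symmL_continuousLinearMapAt _ hy w
  simp only [coord, ContinuousLinearMap.comp_apply, this]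

theorem AlmostContactMetric.eventually_tangentCoord_φ {f : M → N} {p : M} (hf : ContinuousAt f p)
    (Z : FieldAlong d f) :
    (fun q ↦ tangentCoord (f p) (f q) (A.apply Z q)) =ᶠ[𝓝 p]
      fun q ↦ A.coord (f p) (f q) (tangentCoord (f p) (f q) (Z q)) := by
  filter_upwards [hf.eventually ((trivializationAt (EuclideanSpace ℝ (Fin d))
    (TangentSpace (𝓡 d)) (f p)).open_baseSet.mem_nhds (mem_baseSet_self (f p)))] with q hq
    using A.tangentCoord_φ hq _

/-- Product rule for φ in coordinates. The first term on the right sees Z only through Z p, hence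
agrees with the one for any field on N extending Z p. -/
theorem AlmostContactMetric.mvfderiv_tangentCoord_φ {f : M → N} {p : M} {Z : FieldAlong d f}
    (hZ : IsDiffAlong m f Z p) (v : TangentSpace (𝓡 m) p) :
    tangentCoordSymm (f p) (f p)
        (mvfderiv (𝓡 m) (fun q ↦ tangentCoord (f p) (f q) (A.apply Z q)) p v) =
      tangentCoordSymm (f p) (f p)
        (mvfderiv (𝓡 d) (A.coord (f p)) (f p) (mfderiv (𝓡 m) (𝓡 d) f p v)
          (tangentCoord (f p) (f p) (Z p)))
      + A.φ (f p) (tangentCoordSymm (f p) (f p)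
        (mvfderiv (𝓡 m) (fun q ↦ tangentCoord (f p) (f q) (Z q)) p v)) := by
  obtain ⟨hf, hz⟩ := isDiffAlong_iff.1 hZ
  have hA := A.mdifferentiableAt_coord (f p)
  rw [mvfderiv_congr (A.eventually_tangentCoord_φ hf.continuousAt Z),
    mvfderiv_clm_apply (A := fun q ↦ A.coord (f p) (f q)) (hA.comp p hf) hz, map_add]
  congr 1
  · congr 2
    exact DFunLike.congr_fun (mfderiv_comp p hA hf) v
  · rw [coord, ContinuousLinearMap.comp_apply, ContinuousLinearMap.comp_apply,
      tangentCoordSymm_tangentCoord]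

theorem AlmostContactMetric.isDiffField_φ {Y : ∀ y : N, TangentSpace (𝓡 d) y} {x : N}
    (hY : IsDiffField d Y x) : IsDiffField d (fun y ↦ A.φ y (Y y)) x :=
  (A.φ_smooth.contMDiffAt.mdifferentiableAt (by simp)).clm_bundle_apply hY

/-- The formula for `(∇_X φ) Y` holds for vector fields along a map. -/
theorem AlmostContactMetric.IsKenmotsu.covAlong_φ {A : AlmostContactMetric g}
    {hatNabla : AffineConnection d N}
    (hK : A.IsKenmotsu hatNabla) {f : M → N} {p : M} {Z : FieldAlong d f}
    (hZ : IsDiffAlong m f Z p) (v : TangentSpace (𝓡 m) p) :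
    covAlong hatNabla f (A.apply Z) p v - A.φ (f p) (covAlong hatNabla f Z p v) =
      A.η (f p) (Z p) • A.φ (f p) (mfderiv (𝓡 m) (𝓡 d) f p v)
        - g.val (f p) (A.φ (f p) (mfderiv (𝓡 m) (𝓡 d) f p v)) (Z p) • A.ν (f p) := by
  have hf := (isDiffAlong_iff.1 hZ).1
  set W := FiberBundle.extend (EuclideanSpace ℝ (Fin d)) (Z p)
  have hW : IsDiffField d W (f p) := isDiffField_extend (f p) (Z p)
  have hWx : W (f p) = Z p := FiberBundle.extend_apply_self ..
  have h := hK.1 (f p) (mfderiv (𝓡 m) (𝓡 d) f p v) W hW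
  have hAW := AffineConnection.eq_coord hatNabla (A.isDiffField_φ hW)
    (mfderiv (𝓡 m) (𝓡 d) f p v)
  have h0 : mvfderiv (𝓡 d) (fun y ↦ tangentCoord (f p) y (W y)) (f p) = 0 :=
    mvfderiv_tangentCoord_extend _
  have h1 := A.mvfderiv_tangentCoord_φ (f := id) (m := d) hW (mfderiv (𝓡 m) (𝓡 d) f p v)
  rw [covAlong_eq _ hf.continuousAt, covAlong_eq _ hf.continuousAt, A.mvfderiv_tangentCoord_φ hZ,
    map_add]
  -- Since W has constant coordinates, only the derivative of φ itself survives; this is the term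
  -- shared with Z.
  have h2 : tangentCoordSymm (f p) (f p) (mvfderiv (𝓡 d) (fun y ↦ tangentCoord (f p) y
      (A.φ y (W y))) (f p) (mfderiv (𝓡 m) (𝓡 d) f p v)) =
      tangentCoordSymm (f p) (f p) (mvfderiv (𝓡 d) (A.coord (f p)) (f p)
        (mfderiv (𝓡 m) (𝓡 d) f p v) (tangentCoord (f p) (f p) (Z p))) := by
    refine h1.trans ?_
    simp only [id_eq, mfderiv_id, ContinuousLinearMap.coe_id', h0, hWx]
    simp
  rw [hAW, h2, hWx] at h
  rw [← h, AlmostContactMetric.apply]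
  abel

end Kenmotsu

/-! ### Torsion-freeness along a map. -/

section Torsion

variable {d m : ℕ} {N : Type*} [TopologicalSpace N] [ChartedSpace (EuclideanSpace ℝ (Fin d)) N]
  [IsManifold (𝓡 d) ∞ N]
  {M : Type*} [TopologicalSpace M] [ChartedSpace (EuclideanSpace ℝ (Fin m)) M]
  [IsManifold (𝓡 m) ∞ M]

theorem tangentCoord_eq_mvfderiv {x y : N} (hy : y ∈ (chartAt (EuclideanSpace ℝ (Fin d)) x).source)
    (w : TangentSpace (𝓡 d) y) :
    tangentCoord x y w = mvfderiv (𝓡 d) (extChartAt (𝓡 d) x) y w :=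
  DFunLike.congr_fun (TangentBundle.continuousLinearMapAt_trivializationAt hy) w

/-- Fields with constant coordinates commute: apply `mvfderiv_mlieBracket` to the chart, where both
iterated derivatives vanish and whose derivative at x is injective. -/
theorem mlieBracket_extend (x : N) (u w : TangentSpace (𝓡 d) x) :
    VectorField.mlieBracket (𝓡 d) (FiberBundle.extend (EuclideanSpace ℝ (Fin d)) u)
      (FiberBundle.extend (EuclideanSpace ℝ (Fin d)) w) x = 0 := by
  have h := mvfderiv_mlieBracket (f := extChartAt (𝓡 d) x)
    (contMDiffAt_extChartAt) (isDiffField_extend x u)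
    (isDiffField_extend x w)
  have hc : ∀ w : TangentSpace (𝓡 d) x,
      (fun y ↦ mvfderiv (𝓡 d) (extChartAt (𝓡 d) x) y
        (FiberBundle.extend (EuclideanSpace ℝ (Fin d)) w y)) =ᶠ[𝓝 x]
      fun y ↦ tangentCoord x y (FiberBundle.extend (EuclideanSpace ℝ (Fin d)) w y) := by
    intro w
    filter_upwards [(chartAt (EuclideanSpace ℝ (Fin d)) x).open_source.mem_nhds
      (mem_chart_source _ x)] with y hy
    exact (tangentCoord_eq_mvfderiv hy _).symm
  rw [mvfderiv_congr (hc u), mvfderiv_congr (hc w), mvfderiv_tangentCoord_extend,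
    mvfderiv_tangentCoord_extend, ← tangentCoord_eq_mvfderiv (mem_chart_source _ x)] at h
  rw [← tangentCoordSymm_tangentCoord x (VectorField.mlieBracket _ _ _ x), ← h]
  simp

/-- The connection along `f` induced by a torsion-free connection:
`∇_X (df Y) - ∇_Y (df X) = df [X, Y]`. -/
theorem AffineConnection.IsTorsionFree.covAlong_sub {nabla : AffineConnection d N}
    (hn : AffineConnection.IsTorsionFree nabla) {f : M → N} (hf : ContMDiff (𝓡 m) (𝓡 d) ∞ f)
    {X Y : ∀ p : M, TangentSpace (𝓡 m) p} {p : M} (hX : IsDiffField m X p)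
    (hY : IsDiffField m Y p) :
    covAlong nabla f (pushField f Y) p (X p) - covAlong nabla f (pushField f X) p (Y p) =
      pushField f (VectorField.mlieBracket (𝓡 m) X Y) p := by
  have hfc : ContinuousAt f p := hf.continuous.continuousAt
  have hψ : ContMDiffAt (𝓡 d) (𝓡 d) 2 (extChartAt (𝓡 d) (f p)) (f p) := contMDiffAt_extChartAt
  -- The derivative of the chart composed with f along Z is the coordinate vector of df(Z), so the
  -- coordinate parts of the two covariant derivatives differ by df[X, Y].
  have h := mvfderiv_mlieBracket (f := extChartAt (𝓡 d) (f p) ∘ f)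
    (hψ.comp p (hf.contMDiffAt.of_le ENat.LEInfty.out)) hX hY
  have hsrc : ∀ᶠ q in 𝓝 p, f q ∈ (chartAt (EuclideanSpace ℝ (Fin d)) (f p)).source :=
    hfc.eventually ((chartAt (EuclideanSpace ℝ (Fin d)) (f p)).open_source.mem_nhds
      (mem_chart_source _ (f p)))
  have hpt : ∀ (Z : ∀ p : M, TangentSpace (𝓡 m) p) (q : M),
      f q ∈ (chartAt (EuclideanSpace ℝ (Fin d)) (f p)).source →
      mvfderiv (𝓡 m) (extChartAt (𝓡 d) (f p) ∘ f) q (Z q) =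
        tangentCoord (f p) (f q) (pushField f Z q) := by
    intro Z q hq
    rw [tangentCoord_eq_mvfderiv hq]
    exact DFunLike.congr_fun (mfderiv_comp q (mdifferentiableAt_extChartAt hq)
      (hf.contMDiffAt.mdifferentiableAt (by simp))) (Z q)
  have hc : ∀ Z : ∀ p : M, TangentSpace (𝓡 m) p,
      (fun q ↦ mvfderiv (𝓡 m) (extChartAt (𝓡 d) (f p) ∘ f) q (Z q)) =ᶠ[𝓝 p]
        fun q ↦ tangentCoord (f p) (f q) (pushField f Z q) := by
    intro Z
    filter_upwards [hsrc] with q hq using hpt Z q hq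
  rw [mvfderiv_congr (hc X), mvfderiv_congr (hc Y), hpt _ p (mem_chart_source _ _)] at h
  -- The Christoffel parts cancel, because the extensions commute at f p.
  have ht := hn (f p) (FiberBundle.extend (EuclideanSpace ℝ (Fin d)) (pushField f X p))
    (FiberBundle.extend (EuclideanSpace ℝ (Fin d)) (pushField f Y p))
    (isDiffField_extend (f p) (pushField f X p))
    (isDiffField_extend (f p) (pushField f Y p))
  rw [mlieBracket_extend, FiberBundle.extend_apply_self, FiberBundle.extend_apply_self] at ht
  rw [covAlong_eq _ hfc, covAlong_eq _ hfc, add_sub_add_comm, ← map_sub, h,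
    tangentCoordSymm_tangentCoord]
  exact (congrArg _ ht).trans (add_zero _)

end Torsion

/-! ### Global smooth sections of subbundles along the immersion. -/

section Sections

variable {d m : ℕ} {N : Type*} [TopologicalSpace N] [ChartedSpace (EuclideanSpace ℝ (Fin d)) N]
  [IsManifold (𝓡 d) ∞ N]
  {M : Type*} [TopologicalSpace M] [ChartedSpace (EuclideanSpace ℝ (Fin m)) M]

theorem contMDiffAt_along_iff {i : M → N} {Z : FieldAlong d i} {p : M} :
    ContMDiffAt (𝓡 m) ((𝓡 d).prod 𝓘(ℝ, EuclideanSpace ℝ (Fin d))) ∞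
      (fun q ↦ (⟨i q, Z q⟩ : TangentBundle (𝓡 d) N)) p ↔
    ContMDiffAt (𝓡 m) (𝓡 d) ∞ i p ∧ ContMDiffAt (𝓡 m) 𝓘(ℝ, EuclideanSpace ℝ (Fin d)) ∞
      (fun q ↦ tangentCoord (i p) (i q) (Z q)) p := by
  rw [contMDiffAt_totalSpace]
  refine and_congr_right fun hi ↦ ?_
  exact (eventually_tangentCoord hi.continuousAt Z).symm.contMDiffAt_iff

/-- Every vector of a subbundle of `i^* TN` is a value of a global smooth section. -/
theorem IsSubbundle.exists_isSection [T2Space M] [IsManifold (𝓡 m) ∞ M] {i : M → N}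
    (hi : ContMDiff (𝓡 m) (𝓡 d) ∞ i)
    {k : ℕ} {F : FibreFamily d i} (hF : IsSubbundle m i k F) {p : M}
    {v : TangentSpace (𝓡 d) (i p)} (hv : v ∈ F p) :
    ∃ Z : FieldAlong d i, IsSection m i F Z ∧ Z p = v := by
  obtain ⟨U, s, hp, hs⟩ := hF p
  rw [← hs.span_eq p hp] at hv
  obtain ⟨c, rfl⟩ := (Submodule.mem_span_range_iff_exists_fun ℝ).1 hv
  -- A bump function with support inside the frame domain cuts off the constant-coefficient
  -- combination of the frame, which then extends by zero.
  obtain ⟨f, -, hf⟩ := (SmoothBumpFunction.nhds_basis_tsupport (I := 𝓡 m) p).mem_iff.1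
    (hs.isOpen.mem_nhds hp)
  refine ⟨fun q ↦ f q • ∑ j, c j • s j q, ⟨?_, fun q ↦ ?_⟩, by simp⟩
  · intro q _
    refine ContMDiffAt.contMDiffWithinAt (contMDiffAt_along_iff.2 ⟨hi q, ?_⟩)
    by_cases hq : q ∈ tsupport f
    · have h : ∀ j, ContMDiffAt (𝓡 m) 𝓘(ℝ, EuclideanSpace ℝ (Fin d)) ∞
          (fun q' ↦ tangentCoord (i q) (i q') (s j q')) q := fun j ↦
        (contMDiffAt_along_iff.1 ((hs.smooth j).contMDiffAt (hs.isOpen.mem_nhds (hf hq)))).2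
      simp only [map_smul, map_sum]
      exact f.contMDiff.contMDiffAt.smul
        (contMDiffAt_finsetSum fun j _ ↦
          ((c j • ContinuousLinearMap.id ℝ (EuclideanSpace ℝ (Fin d))).contMDiff.contMDiffAt.comp q
            (h j)))
    · have : (fun q' ↦ tangentCoord (i q) (i q') (f q' • ∑ j, c j • s j q')) =ᶠ[𝓝 q]
          fun _ ↦ 0 := by
        filter_upwards [(isClosed_tsupport f).isOpen_compl.mem_nhds hq] with q' hq'
        rw [image_eq_zero_of_notMem_tsupport hq', zero_smul, map_zero]
      exact contMDiffAt_const.congr_of_eventuallyEq this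
  · by_cases hq : q ∈ tsupport f
    · rw [← hs.span_eq q (hf hq)]
      exact Submodule.smul_mem _ _ (Submodule.sum_mem _ fun j _ ↦
        Submodule.smul_mem _ _ (Submodule.subset_span ⟨j, rfl⟩))
    · simp only [image_eq_zero_of_notMem_tsupport hq, zero_smul, Submodule.zero_mem]

theorem IsSection.isDiffAlong {i : M → N} {F : FibreFamily d i} {Z : FieldAlong d i}
    (hZ : IsSection m i F Z) (p : M) : IsDiffAlong m i Z p :=
  (contMDiffOn_univ.1 hZ.1).contMDiffAt.mdifferentiableAt (by simp)

theorem IsTangentSection.isSection_pushField [IsManifold (𝓡 m) ∞ M] {i : M → N}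
    (hi : ContMDiff (𝓡 m) (𝓡 d) ∞ i) {F : FibreFamily d i}
    {X : ∀ p : M, TangentSpace (𝓡 m) p} (hX : IsTangentSection i F X) :
    IsSection m i F (pushField i X) :=
  ⟨contMDiffOn_univ.2 ((hi.contMDiff_tangentMap (m := ∞) (by simp)).comp hX.1), hX.2⟩

theorem AlmostContactMetric.isSection_apply {g : SemiRiemannianMetric d N}
    (A : AlmostContactMetric g) {i : M → N} {F G : FibreFamily d i} {Z : FieldAlong d i}
    (hZ : IsSection m i F Z) (hFG : ∀ p, ∀ v ∈ F p, A.φ (i p) v ∈ G p) :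
    IsSection m i G (A.apply Z) := by
  refine ⟨contMDiffOn_univ.2 ?_, fun p ↦ hFG p _ (hZ.2 p)⟩
  have h := contMDiffOn_univ.1 hZ.1
  have hi : ContMDiff (𝓡 m) (𝓡 d) ∞ i := fun p ↦ (contMDiffAt_along_iff.1 h.contMDiffAt).1
  exact (A.φ_smooth.comp hi).clm_bundle_apply h

end Sections

/-! ### Pointwise algebra of almost contact metric structures. -/

section Fibres

namespace AlmostContactMetric

variable {d : ℕ} {N : Type*} [TopologicalSpace N] [ChartedSpace (EuclideanSpace ℝ (Fin d)) N]
  [IsManifold (𝓡 d) ∞ N] {g : SemiRiemannianMetric d N} (A : AlmostContactMetric g)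

theorem g_φ_left (x : N) (u v : TangentSpace (𝓡 d) x) :
    g.val x (A.φ x u) v = -g.val x u (A.φ x v) :=
  eq_neg_of_add_eq_zero_left (A.g_φ x u v)

theorem g_φ_self (x : N) (u : TangentSpace (𝓡 d) x) : g.val x (A.φ x u) u = 0 := by
  have h := A.g_φ x u u
  rw [g.symm x u] at h
  linarith

/-- From η(ν) = 1 one gets φ²ν = 0, and skewness gives η(φν) = 0; hence φ³ν equals both 0 and −φν.
-/
theorem φ_ν (x : N) : A.φ x (A.ν x) = 0 := by
  have h1 : A.η x (A.ν x) = 1 := by rw [← A.g_ν, A.g_ν_ν]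
  have h0 : A.φ x (A.φ x (A.ν x)) = 0 := by rw [A.φ_φ, h1, one_smul, neg_add_cancel]
  have h2 : A.η x (A.φ x (A.ν x)) = 0 := by rw [← A.g_ν, g_φ_self]
  have h3 := A.φ_φ x (A.φ x (A.ν x))
  rw [h0, map_zero, h2, zero_smul, add_zero] at h3
  exact neg_eq_zero.1 h3.symm

theorem η_φ (x : N) (u : TangentSpace (𝓡 d) x) : A.η x (A.φ x u) = 0 := by
  rw [← A.g_ν, g_φ_left, φ_ν, map_zero, neg_zero]

theorem φ_φ_of_η_eq_zero {x : N} {u : TangentSpace (𝓡 d) x} (hu : A.η x u = 0) :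
    A.φ x (A.φ x u) = -u := by
  rw [A.φ_φ, hu, zero_smul, add_zero]

end AlmostContactMetric

end Fibres

/-! ### Pointwise linear algebra of contact CR-lightlike submanifolds. -/

section Fibres

variable {d m : ℕ} {N : Type*} [TopologicalSpace N] [ChartedSpace (EuclideanSpace ℝ (Fin d)) N]
  [IsManifold (𝓡 d) ∞ N]
  {M : Type*} [TopologicalSpace M] [ChartedSpace (EuclideanSpace ℝ (Fin m)) M]
  {g : SemiRiemannianMetric d N} {i : M → N}

theorem mem_tangentFam_of_mem_rad {p : M} {ξ : TangentSpace (𝓡 d) (i p)} (hξ : ξ ∈ g.rad m i p) :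
    ξ ∈ tangentFam m i p := hξ.1

theorem g_tangent_rad {p : M} {t ξ : TangentSpace (𝓡 d) (i p)} (ht : t ∈ tangentFam m i p)
    (hξ : ξ ∈ g.rad m i p) : g.val (i p) t ξ = 0 := hξ.2 t ht

variable [IsManifold (𝓡 m) ∞ M]

namespace LightlikeSubmanifold

variable (L : LightlikeSubmanifold m g i) {p : M}

theorem screen_le {s : TangentSpace (𝓡 d) (i p)} (hs : s ∈ L.screen p) : s ∈ tangentFam m i p :=
  L.screen_sup p ▸ (le_sup_right : L.screen p ≤ g.rad m i p ⊔ L.screen p) hs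

theorem g_tangent_screenTr {t w : TangentSpace (𝓡 d) (i p)} (ht : t ∈ tangentFam m i p)
    (hw : w ∈ L.screenTr p) : g.val (i p) t w = 0 :=
  (L.screenTr_sup p ▸ (le_sup_right : L.screenTr p ≤ g.rad m i p ⊔ L.screenTr p) hw :
    w ∈ g.perp (tangentFam m i) p) t ht

theorem g_screen_ltr {s n : TangentSpace (𝓡 d) (i p)} (hs : s ∈ L.screen p)
    (hn : n ∈ L.ltr p) : g.val (i p) s n = 0 := (L.ltr_le p hn).1 s hs

theorem g_screenTr_ltr {w n : TangentSpace (𝓡 d) (i p)} (hw : w ∈ L.screenTr p)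
    (hn : n ∈ L.ltr p) : g.val (i p) w n = 0 := (L.ltr_le p hn).2 w hw

/-- A section of `ltr(TM)` orthogonal to `Rad(TM)` vanishes. -/
theorem eq_zero_of_mem_ltr {n : TangentSpace (𝓡 d) (i p)} (hn : n ∈ L.ltr p)
    (h : ∀ ξ ∈ g.rad m i p, g.val (i p) n ξ = 0) : n = 0 := by
  obtain ⟨U, ξ, hp, hξ⟩ := L.rad_subbundle p
  obtain ⟨η, hη, hdual⟩ := L.ltr_dual U ξ hξ
  rw [← hη.span_eq p hp] at hn
  obtain ⟨c, rfl⟩ := (Submodule.mem_span_range_iff_exists_fun ℝ).1 hn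
  refine Finset.sum_eq_zero fun j _ ↦ ?_
  have h0 := h (ξ j p) (hξ.span_eq p hp ▸ Submodule.subset_span ⟨j, rfl⟩)
  rw [g.symm] at h0
  have hc : c j = 0 := by simpa [map_sum, (hdual p hp j _).1] using h0
  rw [hc, zero_smul]

/-- The decomposition along `TM ⊕ ltr(TM) ⊕ S(TM^⊥)`. -/
theorem exists_decomposition (p : M) (u : TangentSpace (𝓡 d) (i p)) :
    ∃ t ∈ tangentFam m i p, ∃ n ∈ L.ltr p, ∃ w ∈ L.screenTr p, u = t + n + w ∧
      L.projTangent p u = t ∧ L.projLtr p u = n ∧ L.projScreenTr p u = w := by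
  obtain ⟨h1, h2, h3⟩ := L.isCompl p
  obtain ⟨t, ht, q, hq, rfl⟩ := Submodule.mem_sup.1 (h1.sup_eq_top ▸ Submodule.mem_top (x := u))
  obtain ⟨n, hn, w, hw, rfl⟩ := Submodule.mem_sup.1 hq
  refine ⟨t, ht, n, hn, w, hw, (add_assoc _ _ _).symm, ?_, ?_, ?_⟩
  · rw [projTangent, map_add, Submodule.projection_apply_of_mem_left h1 ht,
      (Submodule.projection_apply_eq_zero_iff h1).2 hq, add_zero]
  · rw [projLtr, add_left_comm, map_add, Submodule.projection_apply_of_mem_left h2 hn,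
      (Submodule.projection_apply_eq_zero_iff h2).2 (Submodule.add_mem_sup ht hw), add_zero]
  · rw [projScreenTr, ← add_assoc, map_add, Submodule.projection_apply_of_mem_left h3 hw,
      (Submodule.projection_apply_eq_zero_iff h3).2 (Submodule.add_mem_sup ht hn), zero_add]

/-- Rad(TM) is orthogonal to TM and to S(TM^⊥). The next two lemmas are alike: S(TM^⊥) is orthogonal
to TM and ltr(TM), and S(TM) to ltr(TM) and S(TM^⊥). -/
theorem g_projLtr {u ξ : TangentSpace (𝓡 d) (i p)} (hξ : ξ ∈ g.rad m i p) :
    g.val (i p) (L.projLtr p u) ξ = g.val (i p) u ξ := by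
  obtain ⟨t, ht, n, hn, w, hw, hu, -, h, -⟩ := L.exists_decomposition p u
  rw [h, hu, map_add, map_add, _root_.add_apply, _root_.add_apply, g_tangent_rad ht hξ,
    g.symm _ w, L.g_tangent_screenTr (mem_tangentFam_of_mem_rad hξ) hw, zero_add, add_zero]

theorem g_projScreenTr {u w' : TangentSpace (𝓡 d) (i p)} (hw' : w' ∈ L.screenTr p) :
    g.val (i p) (L.projScreenTr p u) w' = g.val (i p) u w' := by
  obtain ⟨t, ht, n, hn, w, hw, hu, -, -, h⟩ := L.exists_decomposition p u
  rw [h, hu, map_add, map_add, _root_.add_apply, _root_.add_apply, L.g_tangent_screenTr ht hw',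
    g.symm _ n, L.g_screenTr_ltr hw' hn, zero_add, zero_add]

theorem g_projTangent {u s : TangentSpace (𝓡 d) (i p)} (hs : s ∈ L.screen p) :
    g.val (i p) (L.projTangent p u) s = g.val (i p) u s := by
  obtain ⟨t, ht, n, hn, w, hw, hu, h, -, -⟩ := L.exists_decomposition p u
  rw [h, hu, map_add, map_add, _root_.add_apply, _root_.add_apply, g.symm _ n,
    L.g_screen_ltr hs hn, g.symm _ w, L.g_tangent_screenTr (L.screen_le hs) hw, add_zero, add_zero]

theorem projTangent_mem (p : M) (u : TangentSpace (𝓡 d) (i p)) :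
    L.projTangent p u ∈ tangentFam m i p :=
  Submodule.projection_apply_mem (L.isCompl p).1 u

theorem projTangent_of_mem {u : TangentSpace (𝓡 d) (i p)} (hu : u ∈ tangentFam m i p) :
    L.projTangent p u = u :=
  Submodule.projection_apply_of_mem_left (L.isCompl p).1 hu

end LightlikeSubmanifold

namespace ContactCRLightlike

open LightlikeSubmanifold

variable {A : AlmostContactMetric g} {L : LightlikeSubmanifold m g i}
  (C : ContactCRLightlike A L) {p : M}

include C in
theorem φ_rad_mem {ξ : TangentSpace (𝓡 d) (i p)} (hξ : ξ ∈ g.rad m i p) :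
    A.φ (i p) ξ ∈ L.screen p := by
  rw [← C.screen_eq p]
  exact Submodule.mem_sup_left <| Submodule.mem_sup_left <| Submodule.mem_sup_left
    (Submodule.mem_map_of_mem hξ)

theorem D'_le {b : TangentSpace (𝓡 d) (i p)} (hb : b ∈ C.D' p) : b ∈ L.screen p := by
  rw [← C.screen_eq p]
  exact Submodule.mem_sup_left <| Submodule.mem_sup_left <| Submodule.mem_sup_right hb

theorem D₀_le {a : TangentSpace (𝓡 d) (i p)} (ha : a ∈ C.D₀ p) : a ∈ L.screen p := by
  rw [← C.screen_eq p]
  exact Submodule.mem_sup_left <| Submodule.mem_sup_right ha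

include C in
theorem η_rad {ξ : TangentSpace (𝓡 d) (i p)} (hξ : ξ ∈ g.rad m i p) : A.η (i p) ξ = 0 := by
  rw [← A.g_ν, g.symm, g_tangent_rad (C.ν_tangent p) hξ]

include C in
theorem η_screenTr {w : TangentSpace (𝓡 d) (i p)} (hw : w ∈ L.screenTr p) : A.η (i p) w = 0 := by
  rw [← A.g_ν, g.symm, L.g_tangent_screenTr (C.ν_tangent p) hw]

theorem η_D' {b : TangentSpace (𝓡 d) (i p)} (hb : b ∈ C.D' p) : A.η (i p) b = 0 := by
  rw [← A.g_ν]
  exact C.orthogonal_ν p (Submodule.mem_span_singleton_self _) b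
    (Submodule.mem_sup_left (Submodule.mem_sup_right hb))

/-- L₁ lies in φ(D'), and φ² = −1 on D' because D' is orthogonal to ν. -/
theorem φ_L₁_mem {l : TangentSpace (𝓡 d) (i p)} (hl : l ∈ C.L₁ p) : A.φ (i p) l ∈ C.D' p := by
  obtain ⟨b, hb, rfl⟩ : l ∈ A.map C.D' p := C.map_D' p ▸ Submodule.mem_sup_left hl
  have h := A.φ_φ_of_η_eq_zero (C.η_D' hb)
  exact h ▸ Submodule.neg_mem _ hb

theorem φ_φ_L₁ {l : TangentSpace (𝓡 d) (i p)} (hl : l ∈ C.L₁ p) :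
    A.φ (i p) (A.φ (i p) l) = -l :=
  A.φ_φ_of_η_eq_zero (C.η_screenTr (C.L₁_le p hl))

theorem exists_φ_D' {b : TangentSpace (𝓡 d) (i p)} (hb : b ∈ C.D' p) :
    ∃ l ∈ C.L₁ p, ∃ n ∈ L.ltr p, A.φ (i p) b = l + n := by
  obtain ⟨l, hl, n, hn, h⟩ := Submodule.mem_sup.1
    (C.map_D' p ▸ Submodule.mem_map_of_mem hb : (A.φ (i p)).toLinearMap b ∈ C.L₁ p ⊔ L.ltr p)
  exact ⟨l, hl, n, hn, h.symm⟩

theorem mem_Dν_iff {a : TangentSpace (𝓡 d) (i p)} : a ∈ C.Dν p ↔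
    ∃ ξ ∈ g.rad m i p, ∃ ξ' ∈ g.rad m i p, ∃ e ∈ C.D₀ p, ∃ c : ℝ,
      a = ξ + A.φ (i p) ξ' + e + c • A.ν (i p) := by
  constructor
  · intro h
    obtain ⟨y, hy, z, hz, rfl⟩ := Submodule.mem_sup.1 h
    obtain ⟨y', hy', e, he, rfl⟩ := Submodule.mem_sup.1 hy
    obtain ⟨ξ, hξ, _, ⟨ξ', hξ', rfl⟩, rfl⟩ := Submodule.mem_sup.1 hy'
    obtain ⟨c, rfl⟩ := Submodule.mem_span_singleton.1 hz
    exact ⟨ξ, hξ, ξ', hξ', e, he, c, rfl⟩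
  · rintro ⟨ξ, hξ, ξ', hξ', e, he, c, rfl⟩
    exact Submodule.add_mem_sup (Submodule.add_mem_sup (Submodule.add_mem_sup hξ
      (Submodule.mem_map_of_mem hξ')) he) (Submodule.smul_mem _ _
        (Submodule.mem_span_singleton_self _))

theorem Dν_le {a : TangentSpace (𝓡 d) (i p)} (ha : a ∈ C.Dν p) : a ∈ tangentFam m i p := by
  obtain ⟨ξ, hξ, ξ', hξ', e, he, c, rfl⟩ := C.mem_Dν_iff.1 ha
  exact add_mem (add_mem (add_mem (mem_tangentFam_of_mem_rad hξ) (L.screen_le (C.φ_rad_mem hξ')))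
    (L.screen_le (C.D₀_le he))) (Submodule.smul_mem _ _ (C.ν_tangent p))

/-- φ exchanges Rad(TM) and φ(Rad(TM)), preserves D₀ and kills ν. This is what allows Y to be
replaced by φY. -/
theorem φ_Dν {a : TangentSpace (𝓡 d) (i p)} (ha : a ∈ C.Dν p) : A.φ (i p) a ∈ C.Dν p := by
  obtain ⟨ξ, hξ, ξ', hξ', e, he, c, rfl⟩ := C.mem_Dν_iff.1 ha
  refine C.mem_Dν_iff.2 ⟨-ξ', neg_mem hξ', ξ, hξ, A.φ (i p) e,
    C.map_D₀ p ▸ Submodule.mem_map_of_mem he, 0, ?_⟩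
  rw [map_add, map_add, map_add, map_smul, A.φ_ν, A.φ_φ_of_η_eq_zero (C.η_rad hξ')]
  module

/-- `TM = (D ⊥ {ν}) + D'`. -/
theorem exists_add_of_mem_tangentFam {t : TangentSpace (𝓡 d) (i p)} (ht : t ∈ tangentFam m i p) :
    ∃ a ∈ C.Dν p, ∃ b ∈ C.D' p, t = a + b := by
  rw [← L.screen_sup p, ← C.screen_eq p] at ht
  obtain ⟨ξ, hξ, y, hy, rfl⟩ := Submodule.mem_sup.1 ht
  obtain ⟨y', hy', z, hz, rfl⟩ := Submodule.mem_sup.1 hy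
  obtain ⟨y'', hy'', e, he, rfl⟩ := Submodule.mem_sup.1 hy'
  obtain ⟨_, ⟨ξ', hξ', rfl⟩, b, hb, rfl⟩ := Submodule.mem_sup.1 hy''
  obtain ⟨c, rfl⟩ := Submodule.mem_span_singleton.1 hz
  exact ⟨_, C.mem_Dν_iff.2 ⟨ξ, hξ, ξ', hξ', e, he, c, rfl⟩, b, hb, by
    simp only [ContinuousLinearMap.coe_coe]; abel⟩

/-- `L₁` is non-degenerate. -/
theorem eq_zero_of_mem_L₁ {l : TangentSpace (𝓡 d) (i p)} (hl : l ∈ C.L₁ p)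
    (h : ∀ l' ∈ C.L₁ p, g.val (i p) l l' = 0) : l = 0 := by
  have hb := C.φ_L₁_mem hl
  have hφ := C.φ_φ_L₁ hl
  set b := A.φ (i p) l
  have hbT := L.screen_le (C.D'_le hb)
  -- If l is orthogonal to L₁, then b = φl is orthogonal to all of TM: to D ⊥ {ν} because φ keeps it
  -- tangent, and to D' because φ(D') = L₁ ⊥ ltr(TM). As b also lies in S(TM), it vanishes.
  have hrad : b ∈ g.rad m i p := by
    refine ⟨hbT, fun t ht ↦ ?_⟩
    change g.val (i p) t b = 0
    obtain ⟨a, ha, b', hb', rfl⟩ := C.exists_add_of_mem_tangentFam ht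
    have h1 : g.val (i p) a b = 0 := by
      rw [← neg_eq_zero, ← A.g_φ_left]
      exact L.g_tangent_screenTr (C.Dν_le (C.φ_Dν ha)) (C.L₁_le p hl)
    have h2 : g.val (i p) b' b = 0 := by
      obtain ⟨l', hl', n', hn', h'⟩ := C.exists_φ_D' hb'
      rw [← neg_eq_zero, ← A.g_φ_left, h', map_add, _root_.add_apply, g.symm _ l', h l' hl',
        g.symm _ n', L.g_screenTr_ltr (C.L₁_le p hl) hn', add_zero]
    rw [map_add, _root_.add_apply, h1, h2, add_zero]
  have hb0 : b = 0 := Submodule.disjoint_def.1 (L.screen_disjoint p) b hrad (C.D'_le hb)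
  rw [hb0, map_zero] at hφ
  exact neg_eq_zero.1 hφ.symm

/-- `D ⊥ {ν}` is the orthogonal complement of `φ(Rad(TM)) + φ(L₁)` in `TM`. -/
theorem mem_Dν_iff_orthogonal {t : TangentSpace (𝓡 d) (i p)} (ht : t ∈ tangentFam m i p) :
    t ∈ C.Dν p ↔ (∀ ξ ∈ g.rad m i p, g.val (i p) t (A.φ (i p) ξ) = 0) ∧
      ∀ l ∈ C.L₁ p, g.val (i p) t (A.φ (i p) l) = 0 := by
  have key : ∀ a ∈ C.Dν p, (∀ ξ ∈ g.rad m i p, g.val (i p) a (A.φ (i p) ξ) = 0) ∧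
      ∀ l ∈ C.L₁ p, g.val (i p) a (A.φ (i p) l) = 0 := fun a ha ↦ by
    have hφa := C.Dν_le (C.φ_Dν ha)
    refine ⟨fun ξ hξ ↦ ?_, fun l hl ↦ ?_⟩
    · rw [← neg_eq_zero, ← A.g_φ_left, g_tangent_rad hφa hξ]
    · rw [← neg_eq_zero, ← A.g_φ_left, L.g_tangent_screenTr hφa (C.L₁_le p hl)]
  refine ⟨key t, fun ⟨h1, h2⟩ ↦ ?_⟩
  obtain ⟨a, ha, b, hb, rfl⟩ := C.exists_add_of_mem_tangentFam ht
  obtain ⟨k1, k2⟩ := key a ha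
  obtain ⟨l, hl, n, hn, hφb⟩ := C.exists_φ_D' hb
  -- Only the D' component b matters. In φb = l + n, orthogonality to φ(Rad(TM)) kills n by duality,
  -- orthogonality to φ(L₁) kills l by non-degeneracy, and φ² = −1 on D' gives b = 0.
  have hn0 : n = 0 := by
    refine L.eq_zero_of_mem_ltr hn fun ξ hξ ↦ ?_
    have h := h1 ξ hξ
    rwa [map_add, _root_.add_apply, k1 ξ hξ, zero_add, ← neg_eq_zero, ← A.g_φ_left, hφb, map_add,
      _root_.add_apply, g.symm _ l, L.g_tangent_screenTr (mem_tangentFam_of_mem_rad hξ)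
        (C.L₁_le p hl), zero_add] at h
  have hl0 : l = 0 := by
    refine C.eq_zero_of_mem_L₁ hl fun l' hl' ↦ ?_
    have h := h2 l' hl'
    rwa [map_add, _root_.add_apply, k2 l' hl', zero_add, ← neg_eq_zero, ← A.g_φ_left, hφb, hn0,
      add_zero] at h
  have hb0 : b = 0 := by
    have h := A.φ_φ_of_η_eq_zero (C.η_D' hb)
    rw [hφb, hn0, hl0, add_zero, map_zero] at h
    exact neg_eq_zero.1 h.symm
  rwa [hb0, add_zero]

/-- The test vectors φξ and φl lie in the screen, which is orthogonal to both transversal bundles,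
so the tangential projection can be dropped from the test. -/
theorem projTangent_mem_Dν_iff {u : TangentSpace (𝓡 d) (i p)} :
    L.projTangent p u ∈ C.Dν p ↔ (∀ ξ ∈ g.rad m i p, g.val (i p) u (A.φ (i p) ξ) = 0) ∧
      ∀ l ∈ C.L₁ p, g.val (i p) u (A.φ (i p) l) = 0 := by
  rw [C.mem_Dν_iff_orthogonal (L.projTangent_mem p u)]
  refine and_congr (forall₂_congr fun ξ hξ ↦ ?_) (forall₂_congr fun l hl ↦ ?_)
  · rw [L.g_projTangent (C.φ_rad_mem hξ)]
  · rw [L.g_projTangent (C.D'_le (C.φ_L₁_mem hl))]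

end ContactCRLightlike

end Fibres

/-! ### The second fundamental forms and the main equivalence. -/

section Main

variable {n m : ℕ} {N : Type*} [TopologicalSpace N]
  [ChartedSpace (EuclideanSpace ℝ (Fin (2 * n + 1))) N] [IsManifold (𝓡 (2 * n + 1)) ∞ N]
  {M : Type*} [TopologicalSpace M] [ChartedSpace (EuclideanSpace ℝ (Fin m)) M]
  {i : M → N}

namespace IndefiniteKenmotsuStatistical

variable (K : IndefiniteKenmotsuStatistical n N)

/-- `∇* + ∇` is twice the Levi-Civita connection, also along a map. -/
theorem covAlong_nablaStar_add_nabla {Z : FieldAlong (2 * n + 1) i} {p : M} (hi : ContinuousAt i p)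
    (v : TangentSpace (𝓡 m) p) :
    covAlong K.nablaStar i Z p v + covAlong K.nabla i Z p v =
      (2 : ℝ) • covAlong K.hatNabla i Z p v := by
  exact (add_comm _ _).trans
    (covAlong_add_covAlong (add_dual_eq K.isLeviCivita K.isStatistical K.isDual) hi v)

variable [IsManifold (𝓡 m) ∞ M] {L : LightlikeSubmanifold m K.g i}
  {X : ∀ p : M, TangentSpace (𝓡 m) p} {Z : FieldAlong (2 * n + 1) i} {p : M}

/-- The dual pair enters the theorem only through this sum and its screen analogue, both of which
depend on the Levi-Civita connection alone. -/
theorem g_hl_add_hl {ξ : TangentSpace (𝓡 (2 * n + 1)) (i p)} (hξ : ξ ∈ K.g.rad m i p) :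
    K.g.val (i p) (L.hl K.nablaStar X Z p) ξ + K.g.val (i p) (L.hl K.nabla X Z p) ξ =
      2 * K.g.val (i p) (covAlong K.hatNabla i Z p (X p)) ξ := by
  rw [LightlikeSubmanifold.hl, LightlikeSubmanifold.hl, L.g_projLtr hξ, L.g_projLtr hξ,
    ← _root_.add_apply, ← map_add,
    K.covAlong_nablaStar_add_nabla L.immersion.contMDiff.continuous.continuousAt, map_smul]
  rfl

theorem g_hs_add_hs {w : TangentSpace (𝓡 (2 * n + 1)) (i p)} (hw : w ∈ L.screenTr p) :
    K.g.val (i p) (L.hs K.nablaStar X Z p) w + K.g.val (i p) (L.hs K.nabla X Z p) w =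
      2 * K.g.val (i p) (covAlong K.hatNabla i Z p (X p)) w := by
  rw [LightlikeSubmanifold.hs, LightlikeSubmanifold.hs, L.g_projScreenTr hw, L.g_projScreenTr hw,
    ← _root_.add_apply, ← map_add,
    K.covAlong_nablaStar_add_nabla L.immersion.contMDiff.continuous.continuousAt, map_smul]
  rfl

variable (C : ContactCRLightlike K.contact L)

include C in
/-- If `w` is orthogonal to `φX` and `ν`, then `g(∇_X φY, w) = -g(∇_X Y, φw)`. -/
theorem g_covAlong_φ {w : TangentSpace (𝓡 (2 * n + 1)) (i p)} (hZ : IsDiffAlong m i Z p)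
    (h : ∀ t ∈ tangentFam m i p, K.g.val (i p) t w = 0)
    (hX : K.contact.φ (i p) (pushField i X p) ∈ tangentFam m i p) :
    K.g.val (i p) (covAlong K.hatNabla i (K.contact.apply Z) p (X p)) w =
      -K.g.val (i p) (covAlong K.hatNabla i Z p (X p)) (K.contact.φ (i p) w) := by
  rw [← K.contact.g_φ_left, sub_eq_iff_eq_add.1 (K.isKenmotsu.covAlong_φ hZ (X p)), map_add,
    map_sub, map_smul, map_smul]
  simp only [_root_.add_apply, _root_.sub_apply, _root_.smul_apply, smul_eq_mul]
  change _ * K.g.val (i p) (K.contact.φ (i p) (pushField i X p)) _ - _ + _ = _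
  -- The terms coming from (∇_X φ)Y are multiples of φX and ν, both tangent to M, hence orthogonal
  -- to w.
  rw [h _ hX, h _ (C.ν_tangent p)]
  ring

/-- `g(∇_X Y, l) = g(∇_X φY, φl)` for `l ∈ L₁`. -/
theorem g_covAlong_L₁ {l : TangentSpace (𝓡 (2 * n + 1)) (i p)} (hZ : IsDiffAlong m i Z p)
    (hl : l ∈ C.L₁ p) (hX : pushField (d := 2 * n + 1) i X p ∈ tangentFam m i p) :
    K.g.val (i p) (covAlong K.hatNabla i Z p (X p)) l =
      K.g.val (i p) (covAlong K.hatNabla i (K.contact.apply Z) p (X p)) (K.contact.φ (i p) l) := by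
  have hη := C.η_screenTr (C.L₁_le p hl)
  -- Here φl need not be normal to M; it is orthogonal to φX because φ preserves the metric up to η,
  -- and η(l) = 0.
  have h1 : K.g.val (i p) (K.contact.φ (i p) (pushField i X p)) (K.contact.φ (i p) l) = 0 := by
    rw [K.contact.g_φ_φ, hη, mul_zero, sub_zero, L.g_tangent_screenTr hX (C.L₁_le p hl)]
  have h2 : K.g.val (i p) (K.contact.ν (i p)) (K.contact.φ (i p) l) = 0 := by
    rw [K.g.symm, K.contact.g_ν, K.contact.η_φ]
  have h3 := K.contact.g_φ_φ (i p) (covAlong K.hatNabla i Z p (X p)) l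
  rw [hη, mul_zero, sub_zero] at h3
  rw [← h3, sub_eq_iff_eq_add.1 (K.isKenmotsu.covAlong_φ hZ (X p)), map_add, map_sub, map_smul,
    map_smul]
  simp only [_root_.add_apply, _root_.sub_apply, _root_.smul_apply, smul_eq_mul]
  change _ = _ * K.g.val (i p) (K.contact.φ (i p) (pushField i X p)) _ - _ + _
  rw [h1, h2]
  ring

end IndefiniteKenmotsuStatistical

end Main
theorem mainTheorem2 (n m : ℕ)
    {N : Type*} [TopologicalSpace N] [T2Space N]
    [ChartedSpace (EuclideanSpace ℝ (Fin (2 * n + 1))) N] [IsManifold (𝓡 (2 * n + 1)) ∞ N]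
    {M : Type*} [TopologicalSpace M] [T2Space M]
    [ChartedSpace (EuclideanSpace ℝ (Fin m)) M] [IsManifold (𝓡 m) ∞ M]
    (K : IndefiniteKenmotsuStatistical n N) (i : M → N)
    (L : LightlikeSubmanifold m K.g i) (C : ContactCRLightlike K.contact L) :
    L.IsTotallyGeodesicFoliation K.hatNabla C.Dν ↔
      ∀ (X : ∀ p : M, TangentSpace (𝓡 m) p) (Y : FieldAlong (2 * n + 1) i),
        IsTangentSection i C.Dν X → IsSection m i C.Dν Y →
          (∀ ξ : FieldAlong (2 * n + 1) i, IsSection m i (K.g.rad m i) ξ → ∀ p,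
            K.g.val (i p) (L.hl K.nablaStar X (K.contact.apply Y) p) (ξ p)
              + K.g.val (i p) (L.hl K.nabla X (K.contact.apply Y) p) (ξ p) = 0) ∧
          (∀ W : FieldAlong (2 * n + 1) i, IsSection m i (K.contact.map C.L₁) W → ∀ p,
            K.g.val (i p) (L.hs K.nablaStar X Y p) (K.contact.apply W p)
              + K.g.val (i p) (L.hs K.nabla X Y p) (K.contact.apply W p) = 0) := by
  have hi : ContMDiff (𝓡 m) (𝓡 (2 * n + 1)) ∞ i := L.immersion.contMDiff
  have hφ : ∀ Y : FieldAlong (2 * n + 1) i, IsSection m i C.Dν Y →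
      IsSection m i C.Dν (K.contact.apply Y) := fun Y hY ↦ K.contact.isSection_apply hY fun p v hv ↦ C.φ_Dν hv
  have hφX : ∀ X : ∀ p : M, TangentSpace (𝓡 m) p, IsTangentSection i C.Dν X → ∀ p,
      K.contact.φ (i p) (pushField i X p) ∈ tangentFam m i p := fun X hX p ↦
    C.Dν_le (C.φ_Dν (hX.2 p))
  constructor
  · rintro ⟨-, hgeo⟩ X Y hX hY
    refine ⟨fun ξ hξ p ↦ ?_, fun W hW p ↦ ?_⟩
    · have h := (C.projTangent_mem_Dν_iff.1 (hgeo X Y hX hY p)).1 (ξ p) (hξ.2 p)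
      rw [K.g_hl_add_hl (hξ.2 p), K.g_covAlong_φ C (hY.isDiffAlong p)
        (fun t ht ↦ g_tangent_rad ht (hξ.2 p)) (hφX X hX p), h, neg_zero, mul_zero]
    · obtain ⟨l, hl, hlW⟩ := hW.2 p
      have hW' : K.contact.apply W p = -l := by
        rw [AlmostContactMetric.apply, ← hlW]
        exact C.φ_φ_L₁ hl
      -- The geodesic property is used for φY, since g(∇_X Y, l) = g(∇_X φY, φl).
      have h := (C.projTangent_mem_Dν_iff.1 (hgeo X _ hX (hφ Y hY) p)).2 l hl
      rw [hW', K.g_hs_add_hs (neg_mem (C.L₁_le p hl)), map_neg,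
        K.g_covAlong_L₁ C (hY.isDiffAlong p) hl (C.Dν_le (hX.2 p)), h, neg_zero, mul_zero]
  · intro H
    have hgeo : ∀ (X : ∀ p : M, TangentSpace (𝓡 m) p) (Y : FieldAlong (2 * n + 1) i),
        IsTangentSection i C.Dν X → IsSection m i C.Dν Y →
        ∀ p, L.induced K.hatNabla X Y p ∈ C.Dν p := by
      intro X Y hX hY p
      refine C.projTangent_mem_Dν_iff.2 ⟨fun ξ hξ ↦ ?_, fun l hl ↦ ?_⟩
      -- The hypothesis concerns global sections, so the vector at p is first extended to one.
      · obtain ⟨Ξ, hΞ, rfl⟩ := L.rad_subbundle.exists_isSection hi hξ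
        have h := (H X Y hX hY).1 Ξ hΞ p
        rw [K.g_hl_add_hl hξ, K.g_covAlong_φ C (hY.isDiffAlong p)
          (fun t ht ↦ g_tangent_rad ht hξ) (hφX X hX p)] at h
        linarith
      · obtain ⟨k, hk⟩ := C.L₁_subbundle
        obtain ⟨Λ, hΛ, rfl⟩ := hk.exists_isSection hi hl
        have hW : IsSection m i (K.contact.map C.L₁) (K.contact.apply Λ) :=
          K.contact.isSection_apply hΛ fun q v hv ↦ Submodule.mem_map_of_mem hv
        -- With W = φΛ and φY in place of Y, the hypothesis controls g(∇_X φY, Λ) = −g(∇_X Y, φΛ),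
        -- the quantity to be killed.
        have h := (H X _ hX (hφ Y hY)).2 _ hW p
        have hW' : K.contact.apply (K.contact.apply Λ) p = -Λ p := C.φ_φ_L₁ hl
        rw [hW', K.g_hs_add_hs (neg_mem (C.L₁_le p hl)), map_neg,
          K.g_covAlong_φ C (hY.isDiffAlong p)
            (fun t ht ↦ L.g_tangent_screenTr ht (C.L₁_le p hl)) (hφX X hX p)] at h
        linarith
    refine ⟨fun X Y hX hY p ↦ ?_, hgeo⟩
    have h := K.isLeviCivita.1.covAlong_sub hi (hX.1.contMDiffAt.mdifferentiableAt (by simp))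
      (hY.1.contMDiffAt.mdifferentiableAt (by simp)) (p := p)
    have hmem : pushField (d := 2 * n + 1) i (VectorField.mlieBracket (𝓡 m) X Y) p ∈
      tangentFam m i p := ⟨_, rfl⟩
    -- The bracket is tangent, hence equals its own projection, which is the difference of two
    -- induced derivatives already known to lie in D ⊥ {ν}.
    rw [← L.projTangent_of_mem hmem, ← h, map_sub]
    exact sub_mem (hgeo X _ hX (hY.isSection_pushField hi) p)
      (hgeo Y _ hY (hX.isSection_pushField hi) p)
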